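/- An instance of generalized sorting with predictions consists of an undirected graph $G=(V,E)$ with $V=\{0,\dots,n-1\}$ and two orientations $\vec P$ and $\vec E$ of $E$ (each edge gets exactly one of its two directions in each of them), where the directed graph $(V,\vec E)$ is acyclic and has a directed Hamiltonian path, while nothing more is assumed about $\vec P$. The input of an algorithm is $(V,E,\vec P)$. The orientation $\vec E$ is fixed in advance and hidden; the algorithm may adaptively probe edges of $G$, and a probe of an edge reveals its direction in $\vec E$. Pairs that are not edges may not be probed. The required output is the directed Hamiltonian path $(v_1,\dots,v_n)$ of $(V,\vec E)$. Let $w=|\vec P\setminus\vec E|$ be the number of mis-predicted edges. Theorem. There are a randomized algorithm (one program for a random access machine with addition and subtraction at unit cost, which can draw uniformly random integers from a given range $\{0,\dots,m\}$ and can probe edges), a constant $C$ and a polynomial $q$ such that the following holds for every instance, with $n=|V|$. Every run of the algorithm halts after at most $q(n)$ steps and outputs the directed Hamiltonian path of $(V,\vec E)$; and with probability at least $1-\frac1n$ over its random choices, the algorithm makes at most $C\,(n\log n+w)$ probes. -/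

import Mathlib

open scoped ENNReal

/-! ### The problem: generalized sorting with predictions -/

/-- `D` is an orientation of the undirected graph `G`: every arc of `D` runs along an edge of `G`,
and every edge of `G` carries exactly one of its two directions. -/
def IsOrientation {V : Type*} (G : SimpleGraph V) (D : Digraph V) : Prop :=
  (∀ u v, D.Adj u v → G.Adj u v) ∧
    ∀ u v, G.Adj u v → (D.Adj u v ∧ ¬ D.Adj v u) ∨ (D.Adj v u ∧ ¬ D.Adj u v)

/-- A directed graph is acyclic: no vertex is joined to itself by a directed walk of
positive length. -/
def IsAcyclicDigraph {V : Type*} (D : Digraph V) : Prop :=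
  ∀ v, ¬ Relation.TransGen D.Adj v v

/-- The list `l` is a directed Hamiltonian path of `D`: it visits every vertex exactly once, and
consecutive entries are arcs of `D`. -/
def IsDirectedHamiltonianPath {V : Type*} (D : Digraph V) (l : List V) : Prop :=
  l.Nodup ∧ (∀ v, v ∈ l) ∧ l.IsChain D.Adj

/-- An instance of generalized sorting with predictions on the vertex set `Fin n`: the graph of
allowed comparisons, the hidden true orientation, which is acyclic and has a directed
Hamiltonian path, and the predicted orientation, which is arbitrary. -/
structure SortingInstance (n : ℕ) where
  /-- the graph of allowed comparisons -/
  G : SimpleGraph (Fin n)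
  /-- the hidden orientation -/
  hidden : Digraph (Fin n)
  /-- the predicted orientation -/
  predicted : Digraph (Fin n)
  hidden_orientation : IsOrientation G hidden
  predicted_orientation : IsOrientation G predicted
  hidden_acyclic : IsAcyclicDigraph hidden
  hidden_hamiltonian : ∃ l, IsDirectedHamiltonianPath hidden l

/-- The number `w` of mis-predicted edges, i.e. of predicted arcs that are not true arcs. -/
noncomputable def SortingInstance.mispredicted {n : ℕ} (I : SortingInstance n) : ℕ :=
  {e : Fin n × Fin n | I.predicted.Adj e.1 e.2 ∧ ¬ I.hidden.Adj e.1 e.2}.ncard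

/-! ### The machine model

A program works on natural-number registers and on natural-number tables (random access memory,
addressed by a table name and two computed indices). The only arithmetic is addition and truncated
subtraction, so that in `t` steps a fixed program creates only numbers with `O(t)` bits beyond
those of the input, and unit-cost time is polynomially related to Turing machine time. There are
two further instructions, one drawing a uniform random number and one probing an edge. -/

/-- Arithmetic expressions. -/
inductive Expr : Type
  /-- a constant -/
  | const (k : ℕ)
  /-- the content of register `x` -/
  | reg (x : ℕ)
  /-- the entry of table `a` in row `i` and column `j` -/
  | entry (a : ℕ) (i j : Expr)
  /-- sum -/
  | add (e f : Expr)
  /-- truncated difference -/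
  | sub (e f : Expr)

/-- Programs. Conditions are expressions, which hold if their value is nonzero. -/
inductive Prog : Type
  /-- set register `x` to `e` -/
  | assign (x : ℕ) (e : Expr)
  /-- set the entry of table `a` in row `i` and column `j` to `e` -/
  | store (a : ℕ) (i j e : Expr)
  /-- set register `x` to a uniformly random element of `{0, …, e}` -/
  | draw (x : ℕ) (e : Expr)
  /-- probe the edge between the vertices numbered `u` and `v`, and set register `x` to `1` if it
  is directed from `u` to `v`, and to `0` if it is directed from `v` to `u` -/
  | probe (x : ℕ) (u v : Expr)
  /-- do nothing -/
  | skip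
  /-- sequential composition -/
  | seq (p q : Prog)
  /-- conditional: `p` if `e` is nonzero, otherwise `q` -/
  | cond (e : Expr) (p q : Prog)
  /-- repeat `p` as long as `e` is nonzero -/
  | loop (e : Expr) (p : Prog)

/-- A configuration: the stack of programs still to be executed (top first), the registers, the
tables, and the number of probes made so far. -/
structure Config : Type where
  /-- programs still to be executed -/
  todo : List Prog
  /-- register contents -/
  regs : ℕ → ℕ
  /-- table contents -/
  tabs : ℕ → ℕ → ℕ → ℕ
  /-- number of probes made so far -/
  probes : ℕ

/-- The value of an expression. -/
def Expr.eval (regs : ℕ → ℕ) (tabs : ℕ → ℕ → ℕ → ℕ) : Expr → ℕ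
  | .const k => k
  | .reg x => regs x
  | .entry a i j => tabs a (i.eval regs tabs) (j.eval regs tabs)
  | .add e f => e.eval regs tabs + f.eval regs tabs
  | .sub e f => e.eval regs tabs - f.eval regs tabs

/-- The value of an expression in a configuration. -/
def Config.value (c : Config) (e : Expr) : ℕ := e.eval c.regs c.tabs

/-- A configuration is halted when nothing is left to be executed. -/
def Config.Halted (c : Config) : Prop := c.todo = []

/-- One step of the machine, as a probability distribution on the next configuration. The oracle
answers probes: `some b` is the direction of the edge, `none` says that the pair is not an edge.
A halted configuration does not change any more, and a machine that tries to probe a pair which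
is not an edge is stuck for ever in its current, not halted, configuration. -/
noncomputable def Config.step (oracle : ℕ → ℕ → Option Bool) (c : Config) : PMF Config :=
  match c.todo with
  | [] => PMF.pure c
  | .assign x e :: r =>
      PMF.pure { c with todo := r, regs := Function.update c.regs x (c.value e) }
  | .store a i j e :: r =>
      PMF.pure { c with
        todo := r
        tabs := Function.update c.tabs a
          (Function.update (c.tabs a) (c.value i)
            (Function.update (c.tabs a (c.value i)) (c.value j) (c.value e))) }
  | .draw x e :: r =>
      (PMF.uniformOfFintype (Fin (c.value e + 1))).map fun k : Fin (c.value e + 1) =>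
        { c with todo := r, regs := Function.update c.regs x (k : ℕ) }
  | .probe x u v :: r =>
      match oracle (c.value u) (c.value v) with
      | none => PMF.pure c
      | some b =>
          PMF.pure { c with
            todo := r
            regs := Function.update c.regs x (if b then 1 else 0)
            probes := c.probes + 1 }
  | .skip :: r => PMF.pure { c with todo := r }
  | .seq p q :: r => PMF.pure { c with todo := p :: q :: r }
  | .cond e p q :: r =>
      PMF.pure { c with todo := (if c.value e ≠ 0 then p else q) :: r }
  | .loop e p :: r =>
      PMF.pure { c with todo := if c.value e ≠ 0 then p :: .loop e p :: r else r }

/-- The distribution of the configuration after `t` steps from `c`. -/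
noncomputable def Config.run (oracle : ℕ → ℕ → Option Bool) (c : Config) : ℕ → PMF Config
  | 0 => PMF.pure c
  | t + 1 => (Config.run oracle c t).bind (Config.step oracle)

/-! ### Input, oracle and output of a sorting program -/

open Classical in
/-- The oracle of an instance: an edge is answered with its hidden direction, and every other pair
of numbers is refused. -/
noncomputable def SortingInstance.oracle {n : ℕ} (I : SortingInstance n) (a b : ℕ) : Option Bool :=
  if h : a < n ∧ b < n then
    if I.G.Adj ⟨a, h.1⟩ ⟨b, h.2⟩ then some (decide (I.hidden.Adj ⟨a, h.1⟩ ⟨b, h.2⟩)) else none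
  else none

open Classical in
/-- The initial configuration of a program on an instance: register `0` holds `n`, table `0` holds
the adjacency matrix of the predicted orientation (which also determines the undirected graph),
and everything else is `0`. The hidden orientation is not part of the input. -/
noncomputable def SortingInstance.init {n : ℕ} (I : SortingInstance n) (p : Prog) : Config where
  todo := [p]
  regs x := if x = 0 then n else 0
  tabs a i j :=
    if h : i < n ∧ j < n then
      if a = 0 ∧ I.predicted.Adj ⟨i, h.1⟩ ⟨j, h.2⟩ then 1 else 0
    else 0
  probes := 0

/-- The configuration has the Hamiltonian path of the hidden orientation as its output: the first
`n` entries of row `0` of table `1` are the vertices of that path, in order. -/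
def SortingInstance.Solved {n : ℕ} (I : SortingInstance n) (c : Config) : Prop :=
  ∃ l : List (Fin n), IsDirectedHamiltonianPath I.hidden l ∧
    (List.range n).map (c.tabs 1 0) = l.map Fin.val

/-! ### Running programs -/

/-! Vertices are inserted one by one into a set on which the hidden reachability relation is known.
A vertex `u` may enter once its correctly predicted in-neighbours are all inserted and pairwise
comparable (`Ideal`). The first vertex of the path that is still missing always qualifies: its
in-neighbours precede it on the path and are comparable along it. Hence `n` rounds of attempts
insert everything (`rel_round`), and the final relation is the order of the path (`rel_final`).

To test readiness, each `u` walks forward through one random ordering of all pairs, shared by all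
vertices. A pair is passed when it is dead for `u`: one member is not a predicted in-neighbour, or
is known to be mispredicted, or the two are comparable. Dead pairs stay dead, so the walk never goes
back. At a live pair not known to be correct, both edges are probed. Either a misprediction is
discovered, which happens at most `w` times, or both predictions are correct and `u` waits there
until the pair becomes comparable; such a waiting position is a left-to-right maximum of the times
at which correct pairs become comparable (`Inv.probe`). When the walk is complete, the unresolved
in-neighbours form a chain, and binary search settles them with `O(log n)` probes
(`card_unknowns_conclude_le`).

The decisive point is that the insertion of `u` at a given attempt depends on `Ideal` alone, not on
the ordering or on what has been probed (`Inv.ideal`, `Inv.not_ideal`). The schedule `rel` and the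
weights derived from it are therefore fixed before the shuffle, and the waiting positions are among
the records of a fixed weight function in a uniformly random order. A supermartingale
(`sum_recordPotential_swap_le`) bounds the expectation of `2 ^ records` by `1 + n²`. Summing over
`u` and applying Markov's inequality (`ends_main`), with probability at least `1 - 1/n` all record
counts are `O(log n)`, and the total is `O(n log n + w)` probes.

Only the shuffle is random. Everything else is verified with the Hoare-style predicate `WP`, while
`Config.Ends` carries the running time and the failure probability backwards through the draws. -/

theorem Config.run_add (o : ℕ → ℕ → Option Bool) (c : Config) (a b : ℕ) :
    Config.run o c (a + b) = (Config.run o c a).bind fun d => Config.run o d b := by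
  induction b with
  | zero => simp [Config.run]
  | succ b ih =>
    rw [← add_assoc]
    simp only [Config.run]
    rw [ih, PMF.bind_bind]

theorem Config.run_one (o : ℕ → ℕ → Option Bool) (c : Config) :
    Config.run o c 1 = Config.step o c := by
  simp [Config.run]

theorem Config.run_of_halted (o : ℕ → ℕ → Option Bool) {c : Config} (h : c.todo = []) (t : ℕ) :
    Config.run o c t = PMF.pure c := by
  induction t with
  | zero => rfl
  | succ t ih => simp [Config.run, ih, Config.step, h]

/-- The memory of the machine: a configuration without the programs still to be executed. -/
structure Mem : Type where
  /-- register contents -/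
  regs : ℕ → ℕ
  /-- table contents -/
  tabs : ℕ → ℕ → ℕ → ℕ
  /-- number of probes made so far -/
  probes : ℕ

namespace Mem

/-- The configuration with a given memory and given programs to be executed. -/
def config (s : Mem) (todo : List Prog) : Config := ⟨todo, s.regs, s.tabs, s.probes⟩

/-- The value of an expression. -/
def value (s : Mem) (e : Expr) : ℕ := e.eval s.regs s.tabs

/-- Set a register. -/
def setReg (s : Mem) (x a : ℕ) : Mem := { s with regs := Function.update s.regs x a }

/-- Set a table entry. -/
def setEntry (s : Mem) (a i j b : ℕ) : Mem :=
  { s with tabs := Function.update s.tabs a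
            (Function.update (s.tabs a) i (Function.update (s.tabs a i) j b)) }

/-- Count one more probe. -/
def probed (s : Mem) : Mem := { s with probes := s.probes + 1 }

variable (s : Mem)

@[simp] theorem value_const (k : ℕ) : s.value (.const k) = k := rfl
@[simp] theorem value_reg (x : ℕ) : s.value (.reg x) = s.regs x := rfl
@[simp] theorem value_entry (a : ℕ) (i j : Expr) :
    s.value (.entry a i j) = s.tabs a (s.value i) (s.value j) := rfl
@[simp] theorem value_add (e f : Expr) : s.value (.add e f) = s.value e + s.value f := rfl
@[simp] theorem value_sub (e f : Expr) : s.value (.sub e f) = s.value e - s.value f := rfl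

@[simp] theorem regs_setReg (x a y : ℕ) :
    (s.setReg x a).regs y = if y = x then a else s.regs y := by
  simp [setReg, Function.update_apply]
@[simp] theorem tabs_setReg (x a : ℕ) : (s.setReg x a).tabs = s.tabs := rfl
@[simp] theorem probes_setReg (x a : ℕ) : (s.setReg x a).probes = s.probes := rfl
@[simp] theorem regs_setEntry (a i j b : ℕ) : (s.setEntry a i j b).regs = s.regs := rfl
@[simp] theorem probes_setEntry (a i j b : ℕ) : (s.setEntry a i j b).probes = s.probes := rfl
@[simp] theorem tabs_setEntry (a i j b a' i' j' : ℕ) :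
    (s.setEntry a i j b).tabs a' i' j' =
      if a' = a ∧ i' = i ∧ j' = j then b else s.tabs a' i' j' := by
  simp only [setEntry, Function.update_apply]
  by_cases ha : a' = a
  · subst ha
    by_cases hi : i' = i
    · subst hi
      simp [Function.update_apply]
    · simp [hi]
  · simp [ha]
@[simp] theorem regs_probed : s.probed.regs = s.regs := rfl
@[simp] theorem tabs_probed : s.probed.tabs = s.tabs := rfl
@[simp] theorem probes_probed : s.probed.probes = s.probes + 1 := rfl

end Mem

/-! ### Total correctness rules for deterministic programs -/

namespace Prog

/-- A bound for the number of steps of a program in which no loop makes more than `M`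
iterations. -/
def time (M : ℕ) : Prog → ℕ
  | .seq p q => p.time M + q.time M + 1
  | .cond _ p q => p.time M + q.time M + 1
  | .loop _ p => M * (p.time M + 1) + 1
  | _ => 1

/-- From memory `s`, the program runs without randomness, in the time allowed by the loop
bound `M`, to a memory that satisfies `Q`. -/
def WP (o : ℕ → ℕ → Option Bool) (M : ℕ) (p : Prog) (Q : Mem → Prop) (s : Mem) : Prop :=
  ∃ s', Q s' ∧ ∃ t ≤ p.time M, ∀ r, Config.run o (s.config (p :: r)) t = PMF.pure (s'.config r)

variable {o : ℕ → ℕ → Option Bool} {M : ℕ} {Q : Mem → Prop} {s : Mem}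

theorem WP.mono {p : Prog} {Q' : Mem → Prop} (h : p.WP o M Q s) (hQ : ∀ s, Q s → Q' s) :
    p.WP o M Q' s := by
  obtain ⟨s', h1, h2⟩ := h
  exact ⟨s', hQ _ h1, h2⟩

theorem WP.assign {x : ℕ} {e : Expr} (h : Q (s.setReg x (s.value e))) :
    (Prog.assign x e).WP o M Q s :=
  ⟨_, h, 1, le_rfl, fun r => by rw [Config.run_one]; rfl⟩

theorem WP.store {a : ℕ} {i j e : Expr}
    (h : Q (s.setEntry a (s.value i) (s.value j) (s.value e))) :
    (Prog.store a i j e).WP o M Q s :=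
  ⟨_, h, 1, le_rfl, fun r => by rw [Config.run_one]; rfl⟩

theorem WP.probe {x : ℕ} {e f : Expr} {b : Bool} (hb : o (s.value e) (s.value f) = some b)
    (h : Q (s.probed.setReg x (if b then 1 else 0))) :
    (Prog.probe x e f).WP o M Q s := by
  refine ⟨_, h, 1, le_rfl, fun r => ?_⟩
  rw [Config.run_one]
  simp only [Config.step, Mem.config, Config.value]
  simp only [Mem.value] at hb
  rw [hb]
  rfl

theorem WP.skip (h : Q s) : Prog.skip.WP o M Q s :=
  ⟨_, h, 1, le_rfl, fun r => by rw [Config.run_one]; rfl⟩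

theorem WP.seq {p q : Prog} (h : p.WP o M (fun s' => q.WP o M Q s') s) :
    (Prog.seq p q).WP o M Q s := by
  obtain ⟨s1, ⟨s2, h2, t2, ht2, hr2⟩, t1, ht1, hr1⟩ := h
  refine ⟨s2, h2, 1 + t1 + t2, by simp only [time]; omega, fun r => ?_⟩
  rw [add_assoc, Config.run_add, Config.run_one]
  simp only [Config.step, Mem.config, PMF.pure_bind]
  rw [Config.run_add]
  have := hr1 (q :: r)
  simp only [Mem.config] at this
  rw [this, PMF.pure_bind]
  exact hr2 r

theorem WP.cond {e : Expr} {p q : Prog} (hp : s.value e ≠ 0 → p.WP o M Q s)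
    (hq : s.value e = 0 → q.WP o M Q s) : (Prog.cond e p q).WP o M Q s := by
  by_cases he : s.value e = 0
  · obtain ⟨s1, h1, t1, ht1, hr1⟩ := hq he
    refine ⟨s1, h1, 1 + t1, by simp only [time]; omega, fun r => ?_⟩
    rw [Config.run_add, Config.run_one]
    simp only [Mem.value] at he
    simp only [Config.step, Mem.config, PMF.pure_bind, Config.value, he]
    exact hr1 r
  · obtain ⟨s1, h1, t1, ht1, hr1⟩ := hp he
    refine ⟨s1, h1, 1 + t1, by simp only [time]; omega, fun r => ?_⟩
    rw [Config.run_add, Config.run_one]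
    simp only [Mem.value] at he
    simp only [Config.step, Mem.config, PMF.pure_bind, Config.value, ne_eq, he, not_false_eq_true,
      if_true]
    exact hr1 r

/-- Total correctness of a loop with invariant `J` and variant `V`. -/
theorem WP.loop {e : Expr} {p : Prog} (J : Mem → Prop) (V : Mem → ℕ) (h0 : J s) (hM : V s ≤ M)
    (hstep : ∀ s, J s → s.value e ≠ 0 → p.WP o M (fun s' => J s' ∧ V s' < V s) s)
    (hend : ∀ s, J s → s.value e = 0 → Q s) : (Prog.loop e p).WP o M Q s := by
  have key : ∀ k s, J s → V s ≤ k → ∃ s', Q s' ∧ ∃ t ≤ k * (p.time M + 1) + 1,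
      ∀ r, Config.run o (s.config (Prog.loop e p :: r)) t = PMF.pure (s'.config r) := by
    intro k
    induction k with
    | zero =>
      intro s hs hV
      have he : s.value e = 0 := by
        by_contra he
        obtain ⟨s', h', -⟩ := hstep s hs he
        omega
      refine ⟨s, hend s hs he, 1, by omega, fun r => ?_⟩
      rw [Config.run_one]
      simp only [Mem.value] at he
      simp [Config.step, Mem.config, Config.value, he]
    | succ k ih =>
      intro s hs hV
      by_cases he : s.value e = 0
      · refine ⟨s, hend s hs he, 1, by omega, fun r => ?_⟩
        rw [Config.run_one]
        simp only [Mem.value] at he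
        simp [Config.step, Mem.config, Config.value, he]
      · obtain ⟨s1, ⟨hs1, hV1⟩, t1, ht1, hr1⟩ := hstep s hs he
        obtain ⟨s2, hs2, t2, ht2, hr2⟩ := ih s1 hs1 (by omega)
        refine ⟨s2, hs2, 1 + t1 + t2, by rw [Nat.succ_mul]; omega, fun r => ?_⟩
        rw [add_assoc, Config.run_add, Config.run_one]
        simp only [Mem.value] at he
        simp only [Config.step, Mem.config, PMF.pure_bind, Config.value, ne_eq, he,
          not_false_eq_true, if_true]
        rw [Config.run_add]
        have := hr1 (Prog.loop e p :: r)
        simp only [Mem.config] at this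
        rw [this, PMF.pure_bind]
        exact hr2 r
  exact key M s h0 hM

/-- Execute `p` for all values of register `x` below the content of register `0`. -/
def forLoop (x : ℕ) (p : Prog) : Prog :=
  .seq (.assign x (.const 0))
    (.loop (.sub (.reg 0) (.reg x)) (.seq p (.assign x (.add (.reg x) (.const 1)))))

/-- The invariant at index `i` refers to the memory in which the counter already holds `i`. The body
therefore establishes it for the memory after the increment, and must leave the bound in register
`0` and the counter intact. -/
theorem WP.forLoop {x n : ℕ} {p : Prog} (J : ℕ → Mem → Prop) (hx : x ≠ 0) (hM : n ≤ M)
    (hn : s.regs 0 = n) (h0 : J 0 (s.setReg x 0))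
    (hstep : ∀ i s, i < n → s.regs 0 = n → s.regs x = i → J i s →
      p.WP o M (fun s' => s'.regs 0 = n ∧ s'.regs x = i ∧ J (i + 1) (s'.setReg x (i + 1))) s)
    (hend : ∀ s, s.regs 0 = n → J n s → Q s) : (Prog.forLoop x p).WP o M Q s := by
  refine WP.seq (WP.assign ?_)
  refine WP.loop (fun s => s.regs 0 = n ∧ s.regs x ≤ n ∧ J (s.regs x) s) (fun s => n - s.regs x)
    ?_ ?_ ?_ ?_
  · simpa [hx.symm, hn] using h0
  · simp only [Mem.value_const, Mem.regs_setReg, if_true]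
    omega
  · rintro s ⟨h0, h1, h2⟩ he
    simp only [Mem.value_sub, Mem.value_reg, h0] at he
    refine WP.seq ((hstep (s.regs x) s (by omega) h0 rfl h2).mono ?_)
    rintro s' ⟨h0', h1', h2'⟩
    refine WP.assign ?_
    simp only [Mem.value_add, Mem.value_reg, Mem.value_const, Mem.regs_setReg, hx.symm, if_true,
      if_false, h0', h1']
    refine ⟨⟨trivial, by omega, h2'⟩, by omega⟩
  · rintro s ⟨h0, h1, h2⟩ he
    simp only [Mem.value_sub, Mem.value_reg, h0] at he
    have : s.regs x = n := by omega
    rw [this] at h2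
    exact hend s h0 h2

/-- Set register `z` to the sum of `e` over all values of register `x` below the content of
register `0`. -/
def sumLoop (z x : ℕ) (e : Expr) : Prog :=
  .seq (.assign z (.const 0)) (forLoop x (.assign z (.add (.reg z) e)))

/-- The summand is evaluated while the accumulator changes, so its value is required for all
register contents that agree with the initial ones off the accumulator and the counter. -/
theorem WP.sumLoop {z x n : ℕ} {e : Expr} (f : ℕ → ℕ) (hx : x ≠ 0) (hz : z ≠ 0) (hxz : x ≠ z)
    (hM : n ≤ M) (hn : s.regs 0 = n)
    (hf : ∀ i regs, (∀ y, y ≠ z → y ≠ x → regs y = s.regs y) → regs x = i → i < n →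
      e.eval regs s.tabs = f i)
    (h : ∀ regs, (∀ y, y ≠ z → y ≠ x → regs y = s.regs y) →
      regs z = ∑ i ∈ Finset.range n, f i → Q ⟨regs, s.tabs, s.probes⟩) :
    (Prog.sumLoop z x e).WP o M Q s := by
  refine WP.seq (WP.assign ?_)
  refine WP.forLoop (n := n) (fun i s' => (∀ y, y ≠ z → y ≠ x → s'.regs y = s.regs y) ∧
    s'.regs z = ∑ i ∈ Finset.range i, f i ∧ s'.tabs = s.tabs ∧ s'.probes = s.probes) hx hM ?_ ?_ ?_ ?_
  · simp [hz.symm, hn]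
  · refine ⟨?_, ?_, rfl, rfl⟩
    · intro y h1 h2
      simp [h1, h2]
    · simp [hxz.symm]
  · rintro i s' hi hn' hx' ⟨h1, h2, h3, h4⟩
    refine WP.assign ?_
    refine ⟨by simp [hz.symm, hn'], by simp [hxz, hx'], ?_, ?_, h3, h4⟩
    · intro y hy1 hy2
      simp [hy1, hy2, h1]
    · have := hf i s'.regs h1 hx' hi
      simp only [Mem.value_add, Mem.value_reg, Mem.regs_setReg, hxz.symm, if_false, if_true, h2,
        Finset.sum_range_succ]
      simp only [Mem.value, h3, this]
  · rintro s' hn' ⟨h1, h2, h3, h4⟩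
    have := h s'.regs h1 h2
    rw [← h3, ← h4] at this
    exact this

end Prog

/-! ### Polynomial bounds -/

/-- The function is bounded by a polynomial. -/
def PolyBounded (f : ℕ → ℕ) : Prop := ∃ q : Polynomial ℕ, ∀ n, f n ≤ q.eval n

namespace PolyBounded

theorem const (k : ℕ) : PolyBounded fun _ => k := ⟨Polynomial.C k, fun n => by simp⟩

theorem id : PolyBounded fun n => n := ⟨Polynomial.X, fun n => by simp⟩

theorem add {f g : ℕ → ℕ} (hf : PolyBounded f) (hg : PolyBounded g) :
    PolyBounded fun n => f n + g n := by
  obtain ⟨p, hp⟩ := hf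
  obtain ⟨q, hq⟩ := hg
  exact ⟨p + q, fun n => by simpa using add_le_add (hp n) (hq n)⟩

theorem mul {f g : ℕ → ℕ} (hf : PolyBounded f) (hg : PolyBounded g) :
    PolyBounded fun n => f n * g n := by
  obtain ⟨p, hp⟩ := hf
  obtain ⟨q, hq⟩ := hg
  exact ⟨p * q, fun n => by simpa using Nat.mul_le_mul (hp n) (hq n)⟩

/-- For a fixed program the time bound is a polynomial in the loop bound, of degree at most the
nesting depth of its loops. -/
theorem time {M : ℕ → ℕ} (hM : PolyBounded M) (p : Prog) : PolyBounded fun n => p.time (M n) := by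
  induction p with
  | seq p q hp hq => exact (hp.add hq).add (const 1)
  | cond e p q hp hq => exact (hp.add hq).add (const 1)
  | loop e p hp => exact (hM.mul (hp.add (const 1))).add (const 1)
  | _ => exact const 1

end PolyBounded

/-! ### Halting with a bound for the probability of failure -/

/-- From `c`, every run is halted after `K` steps in a configuration that satisfies `S`, and
leaves the set `B` with probability at most `ε`. -/
def Config.Ends (o : ℕ → ℕ → Option Bool) (S : Config → Prop) (B : Set Config) (c : Config)
    (K : ℕ) (ε : ℝ≥0∞) : Prop :=
  ∀ t, K ≤ t → (∀ d ∈ (Config.run o c t).support, S d) ∧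
    (Config.run o c t).toOuterMeasure Bᶜ ≤ ε

namespace Config.Ends

variable {o : ℕ → ℕ → Option Bool} {S : Config → Prop} {B : Set Config} {c d : Config} {K : ℕ}
  {ε : ℝ≥0∞}

theorem mono {K' : ℕ} {ε' : ℝ≥0∞} (h : c.Ends o S B K ε) (hK : K ≤ K') (hε : ε ≤ ε') :
    c.Ends o S B K' ε' :=
  fun t ht => ⟨(h t (hK.trans ht)).1, (h t (hK.trans ht)).2.trans hε⟩

theorem of_run {k : ℕ} (h : Config.run o c k = PMF.pure d) (hd : d.Ends o S B K ε) :
    c.Ends o S B (k + K) ε := by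
  intro t ht
  obtain ⟨t', rfl⟩ := Nat.exists_eq_add_of_le (Nat.le_of_add_right_le ht)
  rw [Config.run_add, h, PMF.pure_bind]
  exact hd t' (by omega)

/-- A single outcome fails with probability `0` or `1`, so any `ε` that is at least the indicator of
failure will do; this is what lets Markov's inequality enter pointwise. -/
theorem of_halted (h : d.todo = []) (hS : S d) (hε : d ∉ B → 1 ≤ ε) : d.Ends o S B 0 ε := by
  intro t _
  rw [Config.run_of_halted o h]
  refine ⟨by simpa using hS, ?_⟩
  rw [PMF.toOuterMeasure_pure_apply]
  split_ifs with h'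
  · exact hε h'
  · exact zero_le

theorem of_wp {s : Mem} {M : ℕ} {p : Prog} {r : List Prog} {Q : Mem → Prop}
    (h : p.WP o M Q s) (hQ : ∀ s', Q s' → (s'.config r).Ends o S B K ε) :
    (s.config (p :: r)).Ends o S B (p.time M + K) ε := by
  obtain ⟨s', h1, t, ht, hr⟩ := h
  exact (of_run (hr r) (hQ s' h1)).mono (by omega) le_rfl

/-- By the law of total probability, failure bounds that depend on the drawn number are averaged.
Keeping them dependent is essential for the supermartingale argument. -/
theorem draw {s : Mem} {x : ℕ} {e : Expr} {r : List Prog} {f : ℕ → ℝ≥0∞}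
    (h : ∀ k, k ≤ s.value e → ((s.setReg x k).config r).Ends o S B K (f k)) :
    (s.config (.draw x e :: r)).Ends o S B (1 + K)
      ((∑ k ∈ Finset.range (s.value e + 1), f k) / (s.value e + 1 : ℕ)) := by
  intro t ht
  obtain ⟨t', rfl⟩ := Nat.exists_eq_add_of_le (Nat.le_of_add_right_le ht)
  have hstep : Config.run o (s.config (.draw x e :: r)) 1 =
      (PMF.uniformOfFintype (Fin (s.value e + 1))).map fun k : Fin (s.value e + 1) =>
        (s.setReg x k).config r := by
    rw [Config.run_one]; rfl
  rw [Config.run_add, hstep, PMF.bind_map]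
  refine ⟨?_, ?_⟩
  · intro d hd
    rw [PMF.mem_support_bind_iff] at hd
    obtain ⟨k, -, hk⟩ := hd
    exact (h k (Nat.lt_succ_iff.1 k.2) t' (by omega)).1 d hk
  · rw [PMF.toOuterMeasure_bind_apply, tsum_fintype, ENNReal.div_eq_inv_mul, Finset.sum_range,
      Finset.mul_sum]
    refine Finset.sum_le_sum fun k _ => ?_
    simp only [PMF.uniformOfFintype_apply, Fintype.card_fin]
    gcongr
    exact (h k (Nat.lt_succ_iff.1 k.2) t' (by omega)).2

end Config.Ends

/-! ### Records of a random order -/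

section Records

variable {α : Type*} (f : α → ℕ) (a : ℕ → α)

/-- The weight at position `j` is positive and exceeds all weights at positions below `i`. -/
def Beats (i j : ℕ) : Prop := 0 < f (a j) ∧ ∀ l < i, f (a l) < f (a j)

open Classical in
/-- The number of records at positions below `i`. -/
noncomputable def recordCount (i : ℕ) : ℕ := ((Finset.range i).filter fun j => Beats f a j j).card

open Classical in
/-- A bound for the expectation of `2 ^ recordCount f a N` if the positions from `i` to `N` are
permuted at random. -/
noncomputable def recordPotential (N i : ℕ) : ℕ :=
  2 ^ recordCount f a i * (1 + ((Finset.Ico i N).filter fun j => Beats f a i j).card)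

/-- Before the first draw there are no records and at most `N` candidates. -/
theorem recordPotential_zero_le (N : ℕ) : recordPotential f a N 0 ≤ 1 + N := by
  classical
  have h := Finset.card_filter_le (Finset.Ico 0 N) fun j => Beats f a 0 j
  simp only [Nat.card_Ico, Nat.sub_zero] at h
  simp only [recordPotential, recordCount, Finset.range_zero, Finset.filter_empty,
    Finset.card_empty, pow_zero, one_mul]
  exact Nat.add_le_add_left h 1

theorem recordPotential_self (N : ℕ) : recordPotential f a N N = 2 ^ recordCount f a N := by
  simp [recordPotential]

/-- Counting the strictly ordered pairs from either end shows that the numbers of larger and of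
smaller elements have equal sums; for each element the two together are at most `S.card - 1`. Ties
only help. -/
theorem sum_card_filter_lt_le {ι : Type*} (S : Finset ι) (g : ι → ℕ) :
    ∑ p ∈ S, 2 * (1 + (S.filter fun j => g p < g j).card) ≤ S.card * (S.card + 1) := by
  classical
  have h1 : ∑ p ∈ S, (S.filter fun j => g p < g j).card =
      ∑ p ∈ S, (S.filter fun j => g j < g p).card := by
    simp only [Finset.card_filter]
    exact Finset.sum_comm
  have h2 : ∀ p ∈ S, (S.filter fun j => g p < g j).card + (S.filter fun j => g j < g p).card + 1
      ≤ S.card := by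
    intro p hp
    rw [← Finset.card_union_of_disjoint]
    · refine Nat.succ_le_of_lt (Finset.card_lt_card ?_)
      refine Finset.ssubset_iff_subset_ne.2 ⟨?_, ?_⟩
      · exact Finset.union_subset (Finset.filter_subset _ _) (Finset.filter_subset _ _)
      · intro h
        rw [← h] at hp
        simp at hp
    · rw [Finset.disjoint_filter]
      intro j _ h h'
      omega
  have h3 := Finset.sum_le_sum h2
  simp only [Finset.sum_add_distrib, Finset.sum_const, smul_eq_mul, mul_one, ← h1] at h3
  rw [← Finset.mul_sum, Finset.sum_add_distrib]
  simp only [Finset.sum_const, smul_eq_mul, mul_one]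
  nlinarith

/-- The supermartingale property: a uniform choice of the entry at position `i` does not raise the
expected potential. If the chosen entry is no candidate, neither factor grows. If it is one, the
power of two doubles, but only the candidates of larger weight survive, and on average this
compensates. -/
theorem sum_recordPotential_swap_le {N i : ℕ} (hi : i < N) :
    ∑ k ∈ Finset.range (N - i), recordPotential f (a ∘ Equiv.swap i (i + k)) N (i + 1) ≤
      (N - i) * recordPotential f a N i := by
  classical
  rw [← Finset.sum_Ico_eq_sum_range (fun p => recordPotential f (a ∘ Equiv.swap i p) N (i + 1))]
  set S := (Finset.Ico i N).filter fun j => Beats f a i j with hS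
  have hlow : ∀ p, i ≤ p → ∀ l, l < i → (a ∘ Equiv.swap i p) l = a l := by
    intro p hp l hl
    simp only [Function.comp]
    rw [Equiv.swap_apply_of_ne_of_ne (by omega) (by omega)]
  have hmid : ∀ p, (a ∘ Equiv.swap i p) i = a p := by
    intro p
    simp
  have hrec : ∀ p, i ≤ p → recordCount f (a ∘ Equiv.swap i p) i = recordCount f a i := by
    intro p hp
    unfold recordCount
    congr 1
    refine Finset.filter_congr fun j hj => ?_
    have hj : j < i := Finset.mem_range.1 hj
    unfold Beats
    rw [hlow p hp j hj]
    refine and_congr_right fun _ => forall₂_congr fun l hl => ?_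
    rw [hlow p hp l (by omega)]
  have hbeat : ∀ p, i ≤ p → (Beats f (a ∘ Equiv.swap i p) i i ↔ Beats f a i p) := by
    intro p hp
    unfold Beats
    rw [hmid]
    refine and_congr_right fun _ => forall₂_congr fun l hl => ?_
    rw [hlow p hp l hl]
  have hcard : ∀ p ∈ Finset.Ico i N,
      ((Finset.Ico (i + 1) N).filter fun j => Beats f (a ∘ Equiv.swap i p) (i + 1) j).card ≤
        (S.filter fun j => f (a p) < f (a j)).card := by
    intro p hp
    rw [Finset.mem_Ico] at hp
    -- The swap sends each surviving position to the old position of the same entry, which was a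
    -- candidate heavier than the chosen one.
    refine Finset.card_le_card_of_injOn (Equiv.swap i p) ?_ (Equiv.swap i p).injective.injOn
    intro j hj
    simp only [Finset.coe_filter, Finset.mem_Ico, Set.mem_ofPred_eq] at hj
    obtain ⟨⟨hj1, hj2⟩, hj3, hj4⟩ := hj
    have hmem : i ≤ Equiv.swap i p j ∧ Equiv.swap i p j < N := by
      by_cases h : j = p
      · subst h; simp; omega
      · rw [Equiv.swap_apply_of_ne_of_ne (by omega) h]; omega
    simp only [hS, Finset.coe_filter, Finset.mem_filter, Finset.mem_Ico, Set.mem_ofPred_eq]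
    refine ⟨⟨hmem, hj3, fun l hl => ?_⟩, ?_⟩
    · have := hj4 l (by omega)
      rwa [hlow p hp.1 l hl] at this
    · have := hj4 i (by omega)
      rwa [hmid] at this
  have hterm : ∀ p ∈ Finset.Ico i N, recordPotential f (a ∘ Equiv.swap i p) N (i + 1) ≤
      2 ^ recordCount f a i * if Beats f a i p
        then 2 * (1 + (S.filter fun j => f (a p) < f (a j)).card) else 1 + S.card := by
    intro p hp
    have hp' := (Finset.mem_Ico.1 hp).1
    have hc := hcard p hp
    have hr : recordCount f (a ∘ Equiv.swap i p) (i + 1) =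
        recordCount f a i + if Beats f a i p then 1 else 0 := by
      rw [← hrec p hp']
      simp only [recordCount, Finset.range_add_one, Finset.filter_insert, hbeat p hp']
      split_ifs with h
      · rw [Finset.card_insert_of_notMem (by simp)]
      · rfl
    unfold recordPotential
    rw [hr]
    split_ifs with h
    · rw [pow_succ, mul_assoc]
      gcongr
    · rw [add_zero]
      exact Nat.mul_le_mul_left _ (Nat.add_le_add_left (hc.trans (Finset.card_filter_le _ _)) 1)
  refine (Finset.sum_le_sum hterm).trans ?_
  rw [← Finset.mul_sum, recordPotential, ← mul_assoc, mul_comm (N - i), mul_assoc]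
  gcongr
  -- With `c = S.card`, the candidates contribute at most `c * (c + 1)` and the other `N - i - c`
  -- choices `1 + c` each, in total `(N - i) * (1 + c)`.
  rw [Finset.sum_ite, ← hS, Finset.sum_const, smul_eq_mul]
  have h1 := sum_card_filter_lt_le S fun j => f (a j)
  have h2 := Finset.card_filter_add_card_filter_not (s := Finset.Ico i N) fun j => Beats f a i j
  rw [← hS, Nat.card_Ico] at h2
  rw [← h2]
  nlinarith

end Records

/-! ### The order in which vertices are inserted -/

open Classical in
/-- An instance on natural numbers: predicted arcs `P`, hidden arcs `H`, the hidden Hamiltonian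
path `v` with positions `pos`, and an oracle for the predicted arcs. -/
structure PathInstance where
  /-- number of vertices -/
  n : ℕ
  /-- predicted arcs -/
  P : ℕ → ℕ → Prop
  /-- hidden arcs -/
  H : ℕ → ℕ → Prop
  /-- the hidden Hamiltonian path -/
  v : ℕ → ℕ
  /-- the position of a vertex on the path -/
  pos : ℕ → ℕ
  /-- answers to probes -/
  oracle : ℕ → ℕ → Option Bool
  P_lt : ∀ {x y}, P x y → x < n ∧ y < n
  H_pos : ∀ {x y}, H x y → pos x < pos y
  v_lt : ∀ {i}, i < n → v i < n
  pos_lt : ∀ {x}, x < n → pos x < n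
  pos_v : ∀ {i}, i < n → pos (v i) = i
  v_pos : ∀ {x}, x < n → v (pos x) = x
  H_v : ∀ {i}, i + 1 < n → H (v i) (v (i + 1))
  edge : ∀ {x y}, H x y → P x y ∨ P y x
  P_edge : ∀ {x y}, P x y → H x y ∨ H y x
  oracle_eq : ∀ {x y}, P x y → oracle x y = some (decide (H x y))

namespace PathInstance

variable (I : PathInstance)

theorem H_asymm {x y : ℕ} (h : I.H x y) : ¬ I.H y x := fun h' =>
  absurd (I.H_pos h) (I.H_pos h').asymm

theorem H_lt {x y : ℕ} (h : I.H x y) : x < I.n ∧ y < I.n := by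
  rcases I.edge h with h | h
  · exact I.P_lt h
  · exact (I.P_lt h).symm

/-- Comparability. -/
def Cmp (R : ℕ → ℕ → Prop) (x y : ℕ) : Prop := R x y ∨ R y x

/-- All correctly predicted in-neighbours of `u` are inserted and pairwise comparable. -/
def Ideal (R : ℕ → ℕ → Prop) (u : ℕ) : Prop :=
  ∀ x y, I.P x u → I.H x u → I.P y u → I.H y u → Cmp R x y

/-- `a` is below `u` after the insertion of `u`. -/
def Below (R : ℕ → ℕ → Prop) (u a : ℕ) : Prop := a = u ∨ ∃ x, R a x ∧ I.H x u

/-- `a` is above `u` after the insertion of `u`. -/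
def Above (R : ℕ → ℕ → Prop) (u a : ℕ) : Prop := a = u ∨ ∃ x, I.H u x ∧ R x a

/-- The reachability relation after the insertion of `u`. -/
def insertRel (R : ℕ → ℕ → Prop) (u a b : ℕ) : Prop := R a b ∨ I.Below R u a ∧ I.Above R u b

open Classical in
/-- The reachability relation after the attempt to insert `u`. -/
noncomputable def attemptRel (R : ℕ → ℕ → Prop) (u : ℕ) : ℕ → ℕ → Prop :=
  if R u u ∨ ¬ I.Ideal R u then R else I.insertRel R u

/-- The reachability relation among the inserted vertices after `t` attempts. -/
noncomputable def rel : ℕ → ℕ → ℕ → Prop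
  | 0 => fun _ _ => False
  | t + 1 => I.attemptRel (rel t) (t % I.n)

/-! ### Soundness and progress of the insertion schedule -/

/-- A reachability relation among the vertices `x` with `R x x`. -/
structure Valid (R : ℕ → ℕ → Prop) : Prop where
  lt : ∀ {x y}, R x y → x < I.n ∧ y < I.n
  refl : ∀ {x y}, R x y → R x x ∧ R y y
  trans : ∀ {x y z}, R x y → R y z → R x z
  sound : ∀ {x y}, R x y → I.pos x ≤ I.pos y
  arc : ∀ {x y}, R x x → R y y → I.H x y → R x y

variable {I}

/-- Since `u` is new, `R` has no pair touching it. Hence an old pair composed with a pair through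
`u` again leads through `u`, and two pairs through `u` compose to one. Soundness holds because the
positions along each such connection increase weakly. -/
theorem Valid.insertRel {R : ℕ → ℕ → Prop} {u : ℕ} (h : I.Valid R) (hu : ¬ R u u)
    (hn : u < I.n) : I.Valid (I.insertRel R u) := by
  have hl : ∀ {a}, ¬ R a u := fun h' => hu (h.refl h').2
  have hr : ∀ {a}, ¬ R u a := fun h' => hu (h.refl h').1
  have below_pos : ∀ {a}, I.Below R u a → I.pos a ≤ I.pos u := by
    rintro a (rfl | ⟨x, h1, h2⟩)
    · exact le_rfl
    · exact (h.sound h1).trans (I.H_pos h2).le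
  have above_pos : ∀ {a}, I.Above R u a → I.pos u ≤ I.pos a := by
    rintro a (rfl | ⟨x, h1, h2⟩)
    · exact le_rfl
    · exact (I.H_pos h1).le.trans (h.sound h2)
  have below_refl : ∀ {a}, I.Below R u a → I.insertRel R u a a := by
    rintro a (rfl | ⟨x, h1, h2⟩)
    · exact Or.inr ⟨Or.inl rfl, Or.inl rfl⟩
    · exact Or.inl (h.refl h1).1
  have above_refl : ∀ {a}, I.Above R u a → I.insertRel R u a a := by
    rintro a (rfl | ⟨x, h1, h2⟩)
    · exact Or.inr ⟨Or.inl rfl, Or.inl rfl⟩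
    · exact Or.inl (h.refl h2).2
  have mem : ∀ {a}, I.insertRel R u a a → a = u ∨ R a a := by
    rintro a (h' | ⟨h1, h2⟩)
    · exact Or.inr h'
    · rcases h1 with h1 | ⟨x, h1, -⟩
      · exact Or.inl h1
      · exact Or.inr (h.refl h1).1
  refine ⟨?_, ?_, ?_, ?_, ?_⟩
  · rintro x y (h' | ⟨h1, h2⟩)
    · exact h.lt h'
    · constructor
      · rcases h1 with rfl | ⟨z, h1, -⟩
        · exact hn
        · exact (h.lt h1).1
      · rcases h2 with rfl | ⟨z, -, h2⟩
        · exact hn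
        · exact (h.lt h2).2
  · rintro x y (h' | ⟨h1, h2⟩)
    · exact ⟨Or.inl (h.refl h').1, Or.inl (h.refl h').2⟩
    · exact ⟨below_refl h1, above_refl h2⟩
  · rintro x y z (h1 | ⟨h1, h1'⟩) (h2 | ⟨h2, h2'⟩)
    · exact Or.inl (h.trans h1 h2)
    · refine Or.inr ⟨?_, h2'⟩
      rcases h2 with rfl | ⟨w, h2, h3⟩
      · exact (hl h1).elim
      · exact Or.inr ⟨w, h.trans h1 h2, h3⟩
    · refine Or.inr ⟨h1, ?_⟩
      rcases h1' with rfl | ⟨w, h3, h4⟩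
      · exact (hr h2).elim
      · exact Or.inr ⟨w, h3, h.trans h4 h2⟩
    · exact Or.inr ⟨h1, h2'⟩
  · rintro x y (h' | ⟨h1, h2⟩)
    · exact h.sound h'
    · exact (below_pos h1).trans (above_pos h2)
  · intro x y hx hy hxy
    rcases mem hx with rfl | hx'
    · rcases mem hy with rfl | hy'
      · exact hx
      · exact Or.inr ⟨Or.inl rfl, Or.inr ⟨y, hxy, hy'⟩⟩
    · rcases mem hy with rfl | hy'
      · exact Or.inr ⟨Or.inr ⟨x, hx', hxy⟩, Or.inl rfl⟩
      · exact Or.inl (h.arc hx' hy' hxy)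

/-- The relation contains the path between two inserted vertices if it lies in the inserted
part. -/
theorem Valid.rel_v {R : ℕ → ℕ → Prop} (h : I.Valid R) {i j : ℕ} (hij : i ≤ j) (hj : j < I.n)
    (hR : ∀ k ≤ j, R (I.v k) (I.v k)) : R (I.v i) (I.v j) := by
  induction j, hij using Nat.le_induction with
  | base => exact hR i le_rfl
  | succ j hij ih =>
    exact h.trans (ih (by omega) fun k hk => hR k (by omega))
      (h.arc (hR j (by omega)) (hR (j + 1) le_rfl) (I.H_v hj))

variable (I)

theorem valid_rel {t : ℕ} (ht : t ≤ I.n * I.n) : I.Valid (I.rel t) := by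
  induction t with
  | zero => exact ⟨False.elim, False.elim, fun h => h.elim, False.elim, fun h => h.elim⟩
  | succ t ih =>
    -- The bound on `t` excludes a successor when there are no vertices, where `t % I.n` would not
    -- name a vertex.
    have hn : 0 < I.n := Nat.pos_of_ne_zero fun h => by simp [h] at ht
    simp only [rel, attemptRel]
    split_ifs with h
    · exact ih (by omega)
    · push Not at h
      exact (ih (by omega)).insertRel h.1 (Nat.mod_lt _ hn)

theorem rel_mono {t t' : ℕ} (h : t ≤ t') {x y : ℕ} (hR : I.rel t x y) : I.rel t' x y := by
  induction t', h using Nat.le_induction with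
  | base => exact hR
  | succ t' _ ih =>
    simp only [rel, attemptRel]
    split_ifs with h
    · exact ih
    · exact Or.inl ih

/-- Each round gains at least one vertex of the path: true in-neighbours of `I.v i` come earlier on
the path, so they were inserted in earlier rounds and are comparable through the path segment
between them. -/
theorem rel_round {r : ℕ} (hr : r ≤ I.n) {i : ℕ} (hi : i < r) :
    I.rel (r * I.n) (I.v i) (I.v i) := by
  induction r generalizing i with
  | zero => omega
  | succ r ih =>
    rw [Nat.succ_mul]
    rcases Nat.lt_succ_iff_lt_or_eq.1 hi with hi | rfl
    · exact I.rel_mono (Nat.le_add_right _ _) (ih (by omega) hi)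
    · have hv := I.v_lt (i := i) (by omega)
      have hmod : (i * I.n + I.v i) % I.n = I.v i := by
        rw [mul_comm, Nat.mul_add_mod, Nat.mod_eq_of_lt hv]
      have hle : i * I.n + I.v i ≤ I.n * I.n := by nlinarith
      -- This is the attempt of round `i` (counted from zero) that concerns the vertex `I.v i`.
      refine I.rel_mono (t := i * I.n + I.v i + 1) (by omega) ?_
      simp only [rel]
      rw [hmod]
      simp only [attemptRel]
      split_ifs with h
      · rcases h with h | h
        · exact h
        · refine absurd ?_ h
          have key : ∀ x y, I.H x (I.v i) → I.H y (I.v i) → I.pos x ≤ I.pos y →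
              I.rel (i * I.n + I.v i) x y := by
            intro x y hx hy hxy
            have hy' := I.H_pos hy
            rw [I.pos_v (by omega)] at hy'
            rw [← I.v_pos (I.H_lt hx).1, ← I.v_pos (I.H_lt hy).1]
            refine (I.valid_rel hle).rel_v hxy (by omega) fun k hk => ?_
            exact I.rel_mono (Nat.le_add_right _ _) (ih (by omega) (by omega))
          intro x y _ hx _ hy
          rcases le_total (I.pos x) (I.pos y) with hxy | hxy
          · exact Or.inl (key x y hx hy hxy)
          · exact Or.inr (key y x hy hx hxy)
      · exact Or.inr ⟨Or.inl rfl, Or.inl rfl⟩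

theorem rel_final {x y : ℕ} (hx : x < I.n) (hy : y < I.n) :
    I.rel (I.n * I.n) x y ↔ I.pos x ≤ I.pos y := by
  refine ⟨(I.valid_rel le_rfl).sound, fun h => ?_⟩
  rw [← I.v_pos hx, ← I.v_pos hy]
  exact (I.valid_rel le_rfl).rel_v h (I.pos_lt hy) fun k hk =>
    I.rel_round le_rfl (by have := I.pos_lt hy; omega)

/-! ### Insertion times as weights of pairs -/

open Classical in
/-- The weight of a pair of in-neighbours of `u`: later insertion times have higher weights, and
pairs that are not correctly predicted have weight `0`. -/
noncomputable def weight (u : ℕ) (p : ℕ × ℕ) : ℕ :=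
  if I.P p.1 u ∧ I.H p.1 u ∧ I.P p.2 u ∧ I.H p.2 u then
    1 + ((Finset.range (I.n * I.n)).filter fun t => ¬ Cmp (I.rel t) p.1 p.2).card
  else 0

/-- Comparability is never lost, so the times counted by the weight form an initial segment that
ends before `t`. -/
theorem weight_le {u t : ℕ} {p : ℕ × ℕ} (h : Cmp (I.rel t) p.1 p.2) : I.weight u p ≤ 1 + t := by
  classical
  unfold weight
  split_ifs
  · have : ((Finset.range (I.n * I.n)).filter fun t => ¬ Cmp (I.rel t) p.1 p.2) ⊆
        Finset.range t := by
      intro t' ht'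
      rw [Finset.mem_filter] at ht'
      rw [Finset.mem_range]
      by_contra hlt
      exact ht'.2 (h.imp (I.rel_mono (by omega)) (I.rel_mono (by omega)))
    have := Finset.card_le_card this
    rw [Finset.card_range] at this
    convert Nat.add_le_add_left this 1
  · omega

theorem lt_weight {u t : ℕ} {p : ℕ × ℕ} (h : ¬ Cmp (I.rel t) p.1 p.2) (ht : t < I.n * I.n)
    (hp : I.P p.1 u ∧ I.H p.1 u ∧ I.P p.2 u ∧ I.H p.2 u) : 1 + t < I.weight u p := by
  classical
  unfold weight
  rw [if_pos hp]
  have : Finset.range (t + 1) ⊆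
      ((Finset.range (I.n * I.n)).filter fun t => ¬ Cmp (I.rel t) p.1 p.2) := by
    intro t' ht'
    rw [Finset.mem_range] at ht'
    rw [Finset.mem_filter, Finset.mem_range]
    exact ⟨by omega, fun h' => h (h'.imp (I.rel_mono (by omega)) (I.rel_mono (by omega)))⟩
  have := Finset.card_le_card this
  rw [Finset.card_range] at this
  have h2 : t < ((Finset.range (I.n * I.n)).filter fun t => ¬ Cmp (I.rel t) p.1 p.2).card := this
  convert Nat.add_lt_add_left h2 1

end PathInstance

namespace PathInstance

variable (I : PathInstance)

/-! ### Amortized analysis -/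

open Classical in
/-- The number of wrong predictions that are known. -/
noncomputable def knownWrong (K : ℕ → ℕ → Prop) : ℕ :=
  ((Finset.range I.n ×ˢ Finset.range I.n).filter fun e => I.P e.1 e.2 ∧ K e.2 e.1).card

open Classical in
/-- The number of records of `u` at which the scan of the pairs has stopped, if it has come to
position `k`. -/
noncomputable def stops (a : ℕ → ℕ × ℕ) (K : ℕ → ℕ → Prop) (u k : ℕ) : ℕ :=
  ((Finset.range (I.n * I.n)).filter fun i => Beats (I.weight u) a i i ∧
    (i < k ∨ i = k ∧ K (a i).1 u ∧ K (a i).2 u)).card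

open Classical in
/-- The number of inserted vertices. -/
noncomputable def inserted (R : ℕ → ℕ → Prop) : ℕ :=
  ((Finset.range I.n).filter fun u => R u u).card

/-- The bound for the number of probes. -/
noncomputable def cost (a : ℕ → ℕ × ℕ) (R K : ℕ → ℕ → Prop) (ptr : ℕ → ℕ) : ℕ :=
  ∑ u ∈ Finset.range I.n, 2 * I.stops a K u (ptr u) + 2 * I.knownWrong K +
    I.inserted R * Nat.size I.n

variable {I} {a : ℕ → ℕ × ℕ} {R R' K K' : ℕ → ℕ → Prop} {ptr ptr' : ℕ → ℕ}

theorem knownWrong_mono (hK : ∀ x y, K x y → K' x y) : I.knownWrong K ≤ I.knownWrong K' := by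
  classical
  refine Finset.card_le_card fun e he => ?_
  rw [Finset.mem_filter] at he ⊢
  exact ⟨he.1, he.2.1, hK _ _ he.2.2⟩

/-- A stop at the current position remains counted, once, as a passed position when the scan moves
on. -/
theorem stops_mono (hK : ∀ x y, K x y → K' x y) {u k k' : ℕ} (hk : k ≤ k') :
    I.stops a K u k ≤ I.stops a K' u k' := by
  classical
  refine Finset.card_le_card fun i hi => ?_
  rw [Finset.mem_filter] at hi ⊢
  refine ⟨hi.1, hi.2.1, ?_⟩
  rcases hi.2.2 with h | ⟨h1, h2, h3⟩
  · exact Or.inl (h.trans_le hk)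
  · rcases hk.lt_or_eq with h | h
    · exact Or.inl (h1 ▸ h)
    · exact Or.inr ⟨h1.trans h, hK _ _ h2, hK _ _ h3⟩

theorem stops_le (K : ℕ → ℕ → Prop) (u k : ℕ) :
    I.stops a K u k ≤ recordCount (I.weight u) a (I.n * I.n) := by
  classical
  refine Finset.card_le_card fun i hi => ?_
  rw [Finset.mem_filter] at hi ⊢
  exact ⟨hi.1, hi.2.1⟩

theorem inserted_mono (hR : ∀ x y, R x y → R' x y) : I.inserted R ≤ I.inserted R' := by
  classical
  refine Finset.card_le_card fun e he => ?_
  rw [Finset.mem_filter] at he ⊢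
  exact ⟨he.1, hR _ _ he.2⟩

theorem cost_mono (hR : ∀ x y, R x y → R' x y) (hK : ∀ x y, K x y → K' x y)
    (hp : ∀ u, ptr u ≤ ptr' u) : I.cost a R K ptr ≤ I.cost a R' K' ptr' := by
  unfold cost
  have := knownWrong_mono (I := I) hK
  have := inserted_mono (I := I) hR
  gcongr with u hu
  exact stops_mono hK (hp u)

/-- The pair `p` does not prevent the insertion of `u`. -/
def Dead (I : PathInstance) (R K : ℕ → ℕ → Prop) (u : ℕ) (p : ℕ × ℕ) : Prop :=
  ¬ I.P p.1 u ∨ ¬ I.P p.2 u ∨ K u p.1 ∨ K u p.2 ∨ Cmp R p.1 p.2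

theorem Dead.mono {u : ℕ} {p : ℕ × ℕ} (h : I.Dead R K u p) (hR : ∀ x y, R x y → R' x y)
    (hK : ∀ x y, K x y → K' x y) : I.Dead R' K' u p := by
  unfold Dead Cmp at *
  exact h.imp id (Or.imp id (Or.imp (hK _ _) (Or.imp (hK _ _) (Or.imp (hR _ _) (hR _ _)))))

/-- The true direction of the edge between `x` and `u` becomes known. -/
def learn (I : PathInstance) (K : ℕ → ℕ → Prop) (x u b c : ℕ) : Prop :=
  K b c ∨ I.H b c ∧ (b = x ∧ c = u ∨ b = u ∧ c = x)

/-- The invariant of the algorithm after `t` attempts, with the known arcs `K`, the positions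
`ptr` in the order `a` of the pairs, `pr` probes so far, and `e` probes in excess. -/
structure Inv (I : PathInstance) (a : ℕ → ℕ × ℕ) (t : ℕ) (K : ℕ → ℕ → Prop) (ptr : ℕ → ℕ)
    (pr e : ℕ) : Prop where
  sound : ∀ {x y}, K x y → I.H x y
  ptr_le : ∀ u, ptr u ≤ I.n * I.n
  dead : ∀ u, ∀ j < ptr u, I.Dead (I.rel t) K u (a j)
  known : ∀ u, I.rel t u u → ∀ x, I.P x u → K x u ∨ K u x
  probes : pr ≤ I.cost a (I.rel t) K ptr + e

variable {t pr e u : ℕ}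

theorem Inv.learn_more (h : I.Inv a t K ptr pr e) (hK : ∀ x y, K x y → K' x y)
    (hs : ∀ x y, K' x y → I.H x y) {pr' e' : ℕ} (hpr : pr' ≤ I.cost a (I.rel t) K' ptr + e') :
    I.Inv a t K' ptr pr' e' :=
  ⟨fun h' => hs _ _ h', h.ptr_le, fun u j hj => (h.dead u j hj).mono (fun _ _ => id) hK,
    fun u hu x hx => (h.known u hu x hx).imp (hK _ _) (hK _ _), hpr⟩

theorem Inv.advance (h : I.Inv a t K ptr pr e) (hu : ptr u < I.n * I.n)
    (hd : I.Dead (I.rel t) K u (a (ptr u))) :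
    I.Inv a t K (Function.update ptr u (ptr u + 1)) pr e := by
  refine ⟨h.sound, fun w => ?_, fun w j hj => ?_, h.known, ?_⟩
  · rw [Function.update_apply]
    split_ifs
    · omega
    · exact h.ptr_le w
  · rw [Function.update_apply] at hj
    split_ifs at hj with hw
    · subst hw
      rcases Nat.lt_succ_iff_lt_or_eq.1 hj with hj | rfl
      · exact h.dead w j hj
      · exact hd
    · exact h.dead w j hj
  · refine h.probes.trans (Nat.add_le_add_right (cost_mono (fun _ _ => id) (fun _ _ => id)
      fun w => ?_) e)
    rw [Function.update_apply]
    split_ifs with hw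
    · subst hw; omega
    · exact le_rfl

theorem knownWrong_lt (hK : ∀ x y, K x y → K' x y) {x : ℕ} (hx : I.P x u) (h : ¬ K u x)
    (h' : K' u x) : I.knownWrong K < I.knownWrong K' := by
  classical
  refine Finset.card_lt_card ?_
  rw [Finset.ssubset_iff_of_subset]
  · refine ⟨(x, u), ?_, ?_⟩
    · simp [I.P_lt hx, hx, h']
    · simp [h]
  · intro e he
    rw [Finset.mem_filter] at he ⊢
    exact ⟨he.1, he.2.1, hK _ _ he.2.2⟩

theorem learn_mono (x u b c : ℕ) (h : K b c) : I.learn K x u b c := Or.inl h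

theorem learn_sound (hs : ∀ x y, K x y → I.H x y) (x u b c : ℕ) (h : I.learn K x u b c) :
    I.H b c := h.elim (hs _ _) And.left

theorem learn_known {x : ℕ} (h : I.P x u) : I.learn K x u x u ∨ I.learn K x u u x :=
  (I.P_edge h).imp (fun h => Or.inr ⟨h, Or.inl ⟨rfl, rfl⟩⟩) fun h => Or.inr ⟨h, Or.inr ⟨rfl, rfl⟩⟩

/-- The two probes are paid for in one of two ways. If a prediction is wrong, it was not known to be
wrong, since the pair is live, so `knownWrong` grows. If both are correct, the current position
becomes a new stop. -/
theorem Inv.probe (h : I.Inv a t K ptr pr e) (ht : t < I.n * I.n) (hu : ptr u < I.n * I.n)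
    (hd : ¬ I.Dead (I.rel t) K u (a (ptr u)))
    (hk : ¬ (K (a (ptr u)).1 u ∧ K (a (ptr u)).2 u)) :
    I.Inv a t (I.learn (I.learn K (a (ptr u)).1 u) (a (ptr u)).2 u) ptr (pr + 2) e := by
  classical
  unfold Dead at hd
  push Not at hd
  obtain ⟨hx, hy, hx', hy', hc⟩ := hd
  set x := (a (ptr u)).1 with hxdef
  set y := (a (ptr u)).2 with hydef
  set K' := I.learn (I.learn K x u) y u with hK'
  have hmono : ∀ b c, K b c → K' b c := fun b c hbc => Or.inl (Or.inl hbc)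
  refine h.learn_more hmono
    (fun b c => learn_sound (fun b c => learn_sound (fun _ _ => h.sound) x u b c) y u b c) ?_
  have hpr := h.probes
  suffices I.cost a (I.rel t) K ptr + 2 ≤ I.cost a (I.rel t) K' ptr by omega
  have hst_mono : ∀ w ∈ Finset.range I.n, 2 * I.stops a K w (ptr w) ≤ 2 * I.stops a K' w (ptr w) :=
    fun w _ => Nat.mul_le_mul_left _ (stops_mono hmono le_rfl)
  have hwrong := knownWrong_mono (I := I) hmono
  by_cases hgood : I.H x u ∧ I.H y u
  · have : ∑ w ∈ Finset.range I.n, 2 * I.stops a K w (ptr w) + 2 ≤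
        ∑ w ∈ Finset.range I.n, 2 * I.stops a K' w (ptr w) := by
      have hun : u ∈ Finset.range I.n := Finset.mem_range.2 (I.P_lt hx).2
      rw [← Finset.add_sum_erase _ _ hun, ← Finset.add_sum_erase _ _ hun]
      have h1 := Finset.sum_le_sum fun w (hw : w ∈ (Finset.range I.n).erase u) =>
        hst_mono w (Finset.mem_of_mem_erase hw)
      have h2 : I.stops a K u (ptr u) < I.stops a K' u (ptr u) := by
        refine Finset.card_lt_card ?_
        rw [Finset.ssubset_iff_of_subset]
        · refine ⟨ptr u, ?_, ?_⟩
          · rw [Finset.mem_filter, Finset.mem_range]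
            -- The position is a record: its pair is still incomparable at time `t`, whereas every
            -- earlier pair is dead, so that it is either comparable by now or has weight `0`.
            have hlt := I.lt_weight (u := u) (p := a (ptr u)) hc ht ⟨hx, hgood.1, hy, hgood.2⟩
            refine ⟨hu, ⟨by omega, fun l hl => ?_⟩, Or.inr ⟨rfl, ?_, ?_⟩⟩
            · by_cases hl' : I.P (a l).1 u ∧ I.H (a l).1 u ∧ I.P (a l).2 u ∧ I.H (a l).2 u
              · refine lt_of_le_of_lt (I.weight_le ?_) hlt
                rcases h.dead u l hl with hd | hd | hd | hd | hd
                · exact absurd hl'.1 hd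
                · exact absurd hl'.2.2.1 hd
                · exact absurd (h.sound hd) (I.H_asymm hl'.2.1)
                · exact absurd (h.sound hd) (I.H_asymm hl'.2.2.2)
                · exact hd
              · have : I.weight u (a l) = 0 := if_neg hl'
                omega
            · exact Or.inl (Or.inr ⟨hgood.1, Or.inl ⟨rfl, rfl⟩⟩)
            · exact Or.inr ⟨hgood.2, Or.inl ⟨rfl, rfl⟩⟩
          · rw [Finset.mem_filter]
            rintro ⟨-, -, h' | h'⟩
            · omega
            · exact hk h'.2
        · intro i hi
          rw [Finset.mem_filter] at hi ⊢
          refine ⟨hi.1, hi.2.1, hi.2.2.imp id fun h => ⟨h.1, hmono _ _ h.2.1, hmono _ _ h.2.2⟩⟩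
      omega
    unfold cost
    omega
  · have h1 := Finset.sum_le_sum hst_mono
    have h2 : I.knownWrong K < I.knownWrong K' := by
      rw [not_and_or] at hgood
      rcases hgood with hg | hg
      · refine knownWrong_lt hmono hx hx' (Or.inl (Or.inr ⟨?_, Or.inr ⟨rfl, rfl⟩⟩))
        exact (I.P_edge hx).resolve_left hg
      · refine knownWrong_lt hmono hy hy' (Or.inr ⟨?_, Or.inr ⟨rfl, rfl⟩⟩)
        exact (I.P_edge hy).resolve_left hg
    unfold cost
    omega

/-! ### Binary search among the unresolved in-neighbours -/

/-- The edge from `x` to `u` is predicted and its direction is not known. -/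
def Unknown (I : PathInstance) (K : ℕ → ℕ → Prop) (u x : ℕ) : Prop :=
  I.P x u ∧ ¬ K x u ∧ ¬ K u x

open Classical in
/-- The set of predicted in-neighbours of `u` along edges of unknown direction. -/
noncomputable def unknowns (I : PathInstance) (K : ℕ → ℕ → Prop) (u : ℕ) : Finset ℕ :=
  (Finset.range I.n).filter (I.Unknown K u)

theorem mem_unknowns {x : ℕ} : x ∈ I.unknowns K u ↔ I.Unknown K u x := by
  classical
  rw [unknowns, Finset.mem_filter, Finset.mem_range]
  exact ⟨And.right, fun h => ⟨(I.P_lt h.1).1, h⟩⟩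

open Classical in
/-- The number of unknown in-neighbours of `u` up to `m`. -/
noncomputable def rank (I : PathInstance) (R K : ℕ → ℕ → Prop) (u m : ℕ) : ℕ :=
  ((I.unknowns K u).filter fun y => R y m).card

/-- `m` is a median of the unknown in-neighbours of `u`. -/
def IsMedian (I : PathInstance) (R K : ℕ → ℕ → Prop) (u m : ℕ) : Prop :=
  I.Unknown K u m ∧ (I.unknowns K u).card ≤ 2 * I.rank R K u m ∧
    2 * I.rank R K u m ≤ (I.unknowns K u).card + 1

/-- The unknown in-neighbours of `u` are comparable. -/
def IsChain (I : PathInstance) (R K : ℕ → ℕ → Prop) (u : ℕ) : Prop :=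
  ∀ x y, I.Unknown K u x → I.Unknown K u y → Cmp R x y

/-- On a chain `R` is the order of positions, so ranks are injective and take exactly the values
from `1` to the number of unknowns. -/
theorem exists_isMedian (hR : I.Valid R) (hc : I.IsChain R K u)
    (h : (I.unknowns K u).Nonempty) : ∃ m, I.IsMedian R K u m := by
  classical
  set Q := I.unknowns K u with hQ
  have hle : ∀ x ∈ Q, ∀ y ∈ Q, (R x y ↔ I.pos x ≤ I.pos y) := by
    intro x hx y hy
    refine ⟨hR.sound, fun hxy => ?_⟩
    rcases hc x y (mem_unknowns.1 hx) (mem_unknowns.1 hy) with h | h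
    · exact h
    · have : I.pos x = I.pos y := le_antisymm hxy (hR.sound h)
      have : x = y := by rw [← I.v_pos (hR.lt h).1, ← I.v_pos (hR.lt h).2, this]
      rwa [this] at h ⊢
  have hinj : Set.InjOn (I.rank R K u) Q := by
    have hlt : ∀ x ∈ Q, ∀ y ∈ Q, I.pos x < I.pos y → I.rank R K u x < I.rank R K u y := by
      intro x hx y hy hxy
      refine Finset.card_lt_card ?_
      rw [Finset.ssubset_iff_of_subset]
      · refine ⟨y, ?_, ?_⟩
        · rw [Finset.mem_filter]
          exact ⟨hy, (hle y hy y hy).2 le_rfl⟩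
        · rw [Finset.mem_filter, ← hQ, hle y hy x hx]
          omega
      · intro z hz
        rw [Finset.mem_filter, ← hQ] at hz ⊢
        refine ⟨hz.1, (hle z hz.1 y hy).2 ?_⟩
        have := (hle z hz.1 x hx).1 hz.2
        omega
    intro x hx y hy hxy
    rcases lt_trichotomy (I.pos x) (I.pos y) with h | h | h
    · exact absurd hxy (hlt x hx y hy h).ne
    · rw [← I.v_pos (I.P_lt (mem_unknowns.1 hx).1).1, ← I.v_pos (I.P_lt (mem_unknowns.1 hy).1).1, h]
    · exact absurd hxy (hlt y hy x hx h).ne'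
  have himage : Q.image (I.rank R K u) = Finset.Icc 1 Q.card := by
    refine Finset.eq_of_subset_of_card_le ?_ ?_
    · intro k hk
      obtain ⟨x, hx, rfl⟩ := Finset.mem_image.1 hk
      rw [Finset.mem_Icc]
      refine ⟨Finset.card_pos.2 ⟨x, ?_⟩, Finset.card_filter_le _ _⟩
      rw [Finset.mem_filter]
      exact ⟨hx, (hle x hx x hx).2 le_rfl⟩
    · rw [Finset.card_image_of_injOn hinj, Nat.card_Icc]
      omega
  have hpos := Finset.card_pos.2 h
  -- Half of the number of unknowns, rounded up, is the rank that satisfies both inequalities of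
  -- `IsMedian`.
  have : (Q.card + 1) / 2 ∈ Q.image (I.rank R K u) := by
    rw [himage, Finset.mem_Icc]
    omega
  obtain ⟨m, hm, hm'⟩ := Finset.mem_image.1 this
  refine ⟨m, mem_unknowns.1 hm, ?_, ?_⟩ <;> rw [hm', ← hQ] <;> omega

/-- The conclusions from a probe of the edge from `m` to `u` in the search. -/
def conclude (I : PathInstance) (R K : ℕ → ℕ → Prop) (u m b c : ℕ) : Prop :=
  K b c ∨ (I.H m u ∧ c = u ∧ I.Unknown K u b ∧ R b m) ∨
    (I.H u m ∧ b = u ∧ I.Unknown K u c ∧ R m c)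

/-- If the inferred edge had the opposite direction, it would close a cycle with the probed arc and
the reachability, contradicting the order of positions. -/
theorem conclude_sound (hR : I.Valid R) (hs : ∀ x y, K x y → I.H x y) {m b c : ℕ}
    (h : I.conclude R K u m b c) : I.H b c := by
  rcases h with h | ⟨h1, rfl, h3, h4⟩ | ⟨h1, rfl, h3, h4⟩
  · exact hs _ _ h
  · refine (I.P_edge h3.1).resolve_right fun h' => ?_
    have := hR.sound h4
    have := I.H_pos h'
    have := I.H_pos h1
    omega
  · refine (I.P_edge h3.1).resolve_left fun h' => ?_
    have := hR.sound h4
    have := I.H_pos h'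
    have := I.H_pos h1
    omega

theorem unknowns_conclude_subset (m : ℕ) :
    I.unknowns (I.conclude R K u m) u ⊆ I.unknowns K u := by
  intro x hx
  rw [mem_unknowns] at hx ⊢
  exact ⟨hx.1, fun h => hx.2.1 (Or.inl h), fun h => hx.2.2 (Or.inl h)⟩

/-- If the median precedes `u`, so does all that reaches it, and `card - rank` unknowns remain. If
`u` precedes the median, all that the median reaches is settled, including itself, and at most `rank
- 1` remain. -/
theorem card_unknowns_conclude_le (hc : I.IsChain R K u) {m : ℕ} (hm : I.IsMedian R K u m) :
    (I.unknowns (I.conclude R K u m) u).card ≤ (I.unknowns K u).card / 2 := by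
  classical
  obtain ⟨h1, h2, h3⟩ := hm
  have hrefl : R m m := (hc m m h1 h1).elim id id
  have hmem : m ∈ (I.unknowns K u).filter fun y => R y m :=
    Finset.mem_filter.2 ⟨mem_unknowns.2 h1, hrefl⟩
  rcases I.P_edge h1.1 with hH | hH
  · have hsub : I.unknowns (I.conclude R K u m) u ⊆
        (I.unknowns K u).filter fun y => ¬ R y m := by
      intro x hx
      have hx' := unknowns_conclude_subset m hx
      rw [mem_unknowns] at hx
      refine Finset.mem_filter.2 ⟨hx', fun h => hx.2.1 ?_⟩
      exact Or.inr (Or.inl ⟨hH, rfl, mem_unknowns.1 hx', h⟩)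
    have := Finset.card_le_card hsub
    have h4 := Finset.card_filter_add_card_filter_not (s := I.unknowns K u) fun y => R y m
    have h5 : I.rank R K u m = ((I.unknowns K u).filter fun y => R y m).card := rfl
    omega
  · have hsub : I.unknowns (I.conclude R K u m) u ⊆
        ((I.unknowns K u).filter fun y => R y m).erase m := by
      intro x hx
      have hx' := unknowns_conclude_subset m hx
      rw [mem_unknowns] at hx
      have hnot : ¬ R m x := fun h =>
        hx.2.2 (Or.inr (Or.inr ⟨hH, rfl, mem_unknowns.1 hx', h⟩))
      rw [Finset.mem_erase, Finset.mem_filter]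
      refine ⟨?_, hx', (hc m x h1 (mem_unknowns.1 hx')).resolve_left hnot⟩
      rintro rfl
      exact hnot hrefl
    have := Finset.card_le_card hsub
    rw [Finset.card_erase_of_mem hmem] at this
    have h5 : I.rank R K u m = ((I.unknowns K u).filter fun y => R y m).card := rfl
    have := Finset.card_pos.2 ⟨m, hmem⟩
    omega

theorem size_lt_size {b c : ℕ} (hc : 0 < c) (h : b ≤ c / 2) : Nat.size b < Nat.size c := by
  obtain ⟨k, hk⟩ := Nat.exists_eq_succ_of_ne_zero (Nat.size_pos.2 hc).ne'
  have h1 : c < 2 ^ (k + 1) := Nat.size_le.1 hk.le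
  rw [hk, Nat.lt_succ_iff, Nat.size_le]
  rw [pow_succ] at h1
  omega

theorem IsChain.conclude (hc : I.IsChain R K u) (m : ℕ) :
    I.IsChain R (I.conclude R K u m) u := by
  intro x y hx hy
  refine hc x y ?_ ?_
  · exact mem_unknowns.1 (unknowns_conclude_subset m (mem_unknowns.2 hx))
  · exact mem_unknowns.1 (unknowns_conclude_subset m (mem_unknowns.2 hy))

/-- The state of the search for the position of `u`. -/
structure SearchInv (I : PathInstance) (a : ℕ → ℕ × ℕ) (t u : ℕ) (K : ℕ → ℕ → Prop)
    (ptr : ℕ → ℕ) (pr : ℕ) : Prop where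
  inv : ∃ e, I.Inv a t K ptr pr e ∧ e + Nat.size (I.unknowns K u).card ≤ Nat.size I.n
  chain : I.IsChain (I.rel t) K u

/-- Halving the unknowns shortens the binary length of their number, which pays for the one
additional probe in excess. -/
theorem SearchInv.conclude (h : I.SearchInv a t u K ptr pr) (ht : t ≤ I.n * I.n) {m : ℕ}
    (hm : I.IsMedian (I.rel t) K u m) :
    I.SearchInv a t u (I.conclude (I.rel t) K u m) ptr (pr + 1) := by
  obtain ⟨⟨e, hi, he⟩, hc⟩ := h
  refine ⟨⟨e + 1, ?_, ?_⟩, hc.conclude m⟩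
  · refine hi.learn_more (K' := I.conclude (I.rel t) K u m) (fun b c h => Or.inl h)
      (fun b c h => conclude_sound (I.valid_rel ht) (fun _ _ => hi.sound) h) ?_
    have h1 := hi.probes
    have h2 : I.cost a (I.rel t) K ptr ≤ I.cost a (I.rel t) (I.conclude (I.rel t) K u m) ptr :=
      cost_mono (fun _ _ => id) (fun _ _ h => Or.inl h) fun _ => le_rfl
    omega
  · have := size_lt_size (Finset.card_pos.2 ⟨m, mem_unknowns.2 hm.1⟩)
      (card_unknowns_conclude_le hc hm)
    omega

/-- All pairs have been passed, hence are dead, and for two unknown in-neighbours the only possible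
reason is comparability. The diagonal pairs show that each of them is inserted. -/
theorem Inv.searchInv (h : I.Inv a t K ptr pr 0) (hp : ptr u = I.n * I.n)
    (ha : ∀ x < I.n, ∀ y < I.n, ∃ j < I.n * I.n, a j = (x, y)) : I.SearchInv a t u K ptr pr := by
  classical
  refine ⟨⟨0, h, ?_⟩, ?_⟩
  · rw [zero_add]
    refine Nat.size_le_size ((Finset.card_filter_le _ _).trans (Finset.card_range _).le)
  · intro x y hx hy
    obtain ⟨j, hj, hj'⟩ := ha x (I.P_lt hx.1).1 y (I.P_lt hy.1).1
    have := h.dead u j (by omega)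
    rw [hj'] at this
    rcases this with h' | h' | h' | h' | h'
    · exact absurd hx.1 h'
    · exact absurd hy.1 h'
    · exact absurd h' hx.2.2
    · exact absurd h' hy.2.2
    · exact h'

/-- Together with `Inv.not_ideal` this makes the outcome of a scan equivalent to a condition free of
`a` and `K`. It is why the schedule `rel` may be treated as fixed when the pairs are shuffled. -/
theorem Inv.ideal (h : I.Inv a t K ptr pr e) (hp : ptr u = I.n * I.n)
    (ha : ∀ x < I.n, ∀ y < I.n, ∃ j < I.n * I.n, a j = (x, y)) : I.Ideal (I.rel t) u := by
  intro x y hx hx' hy hy'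
  obtain ⟨j, hj, hj'⟩ := ha x (I.P_lt hx).1 y (I.P_lt hy).1
  have := h.dead u j (by omega)
  rw [hj'] at this
  rcases this with h' | h' | h' | h' | h'
  · exact absurd hx h'
  · exact absurd hy h'
  · exact absurd (h.sound h') (I.H_asymm hx')
  · exact absurd (h.sound h') (I.H_asymm hy')
  · exact h'

theorem Inv.not_ideal (h : I.Inv a t K ptr pr e) {p : ℕ × ℕ}
    (hd : ¬ I.Dead (I.rel t) K u p) (h1 : K p.1 u) (h2 : K p.2 u) : ¬ I.Ideal (I.rel t) u := by
  unfold Dead at hd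
  push Not at hd
  exact fun hi => hd.2.2.2.2 (hi p.1 p.2 hd.1 (h.sound h1) hd.2.1 (h.sound h2))

theorem Inv.next_of_rel_eq (h : I.Inv a t K ptr pr e) (hR : I.rel (t + 1) = I.rel t) :
    I.Inv a (t + 1) K ptr pr e := by
  refine ⟨h.sound, h.ptr_le, ?_, ?_, ?_⟩ <;> rw [hR]
  · exact h.dead
  · exact h.known
  · exact h.probes

/-- The arcs between `u` and the inserted vertices are known if no direction is unknown. -/
theorem Inv.known_of_unknowns_eq_empty (h : I.Inv a t K ptr pr e) (hQ : I.unknowns K u = ∅)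
    {x : ℕ} (hx : I.rel t x x) : (K x u ↔ I.H x u) ∧ (K u x ↔ I.H u x) := by
  have hu : ∀ y, I.P y u → K y u ∨ K u y := by
    intro y hy
    by_contra hcon
    rw [not_or] at hcon
    have := mem_unknowns.2 ⟨hy, hcon⟩
    simp [hQ] at this
  -- Predicted arcs into `u` are settled because no unknown is left; a predicted arc from `u` to `x`
  -- was settled when `x` was inserted.
  have hboth : I.P x u ∨ I.P u x → K x u ∨ K u x := by
    rintro (h' | h')
    · exact hu x h'
    · exact (h.known x hx u h').symm
  refine ⟨⟨h.sound, fun h' => ?_⟩, ⟨h.sound, fun h' => ?_⟩⟩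
  · exact (hboth (I.edge h')).resolve_right fun h'' => I.H_asymm h' (h.sound h'')
  · exact (hboth (I.edge h').symm).resolve_left fun h'' => I.H_asymm h' (h.sound h'')

/-- The excess from the search is at most `Nat.size I.n`, exactly what one more inserted vertex adds
to `cost`, so it returns to `0`. -/
theorem SearchInv.insert (h : I.SearchInv a t u K ptr pr) (hQ : I.unknowns K u = ∅)
    (hR : I.rel (t + 1) = I.insertRel (I.rel t) u) (hu : ¬ I.rel t u u) (hn : u < I.n)
    (ht : t ≤ I.n * I.n) : I.Inv a (t + 1) K ptr pr 0 := by
  classical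
  obtain ⟨⟨e, hi, he⟩, hc⟩ := h
  have hmono : ∀ x y, I.rel t x y → I.rel (t + 1) x y := fun x y => I.rel_mono (Nat.le_succ t)
  refine ⟨hi.sound, hi.ptr_le, fun w j hj => (hi.dead w j hj).mono hmono fun _ _ => id, ?_, ?_⟩
  · intro w hw x hx
    rw [hR] at hw
    have hw' : w = u ∨ I.rel t w w := by
      rcases hw with hw | ⟨hw | ⟨y, hw, -⟩, -⟩
      · exact Or.inr hw
      · exact Or.inl hw
      · by_cases h : w = u
        · exact Or.inl h
        · right
          by_contra hcon
          exact hcon ((I.valid_rel ht).refl hw).1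
    rcases hw' with rfl | hw'
    · by_contra hcon
      rw [not_or] at hcon
      have := mem_unknowns.2 ⟨hx, hcon⟩
      simp [hQ] at this
    · exact hi.known w hw' x hx
  · have h1 := hi.probes
    have h2 : I.inserted (I.rel t) < I.inserted (I.rel (t + 1)) := by
      refine Finset.card_lt_card ?_
      rw [Finset.ssubset_iff_of_subset]
      · refine ⟨u, ?_, ?_⟩
        · rw [Finset.mem_filter, hR]
          exact ⟨Finset.mem_range.2 hn, Or.inr ⟨Or.inl rfl, Or.inl rfl⟩⟩
        · simp [hu]
      · intro x hx
        rw [Finset.mem_filter] at hx ⊢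
        exact ⟨hx.1, hmono _ _ hx.2⟩
    have h3 : I.inserted (I.rel t) * Nat.size I.n + Nat.size I.n ≤
        I.inserted (I.rel (t + 1)) * Nat.size I.n := by
      rw [← Nat.succ_mul]
      exact Nat.mul_le_mul_right _ h2
    unfold cost at *
    omega

end PathInstance

/-! ### The program -/

namespace SortProg

/-- Conjunction of truth values. -/
def both (e f : Expr) : Expr := .sub (.add e f) (.const 1)

/-- Negation of truth values. -/
def neg (e : Expr) : Expr := .sub (.const 1) e

/-- Whether the direction of the predicted edge from `y` to the vertex in register `6` is
unknown. -/
def unknown (y : Expr) : Expr :=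
  both (.entry 0 y (.reg 6)) (neg (.add (.entry 3 y (.reg 6)) (.entry 3 (.reg 6) y)))

/-- Probe the edge from the vertex in register `x` to the one in register `6`, and store its
direction. -/
def learn (x : ℕ) : Prog :=
  .seq (.probe 10 (.reg x) (.reg 6))
    (.cond (.reg 10) (.store 3 (.reg x) (.reg 6) (.const 1))
      (.store 3 (.reg 6) (.reg x) (.const 1)))

/-- The scan position of the vertex in register `6`. -/
def position : Expr := .entry 5 (.const 0) (.reg 6)

/-- Whether the pair in registers `8` and `9` does not prevent the insertion of the vertex in
register `6`. -/
def dead : Expr :=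
  .add (neg (.entry 0 (.reg 8) (.reg 6))) (.add (neg (.entry 0 (.reg 9) (.reg 6)))
    (.add (.entry 3 (.reg 6) (.reg 8)) (.add (.entry 3 (.reg 6) (.reg 9))
      (.add (.entry 4 (.reg 8) (.reg 9)) (.entry 4 (.reg 9) (.reg 8))))))

/-- One step of the scan of the pairs for the vertex in register `6`. -/
def scanStep : Prog :=
  .cond (.sub (.reg 1) position)
    (.seq (.assign 8 (.entry 2 (.const 0) position))
      (.seq (.assign 9 (.entry 2 (.const 1) position))
        (.cond dead
          (.store 5 (.const 0) (.reg 6) (.add position (.const 1)))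
          (.cond (both (.entry 3 (.reg 8) (.reg 6)) (.entry 3 (.reg 9) (.reg 6)))
            (.assign 7 (.const 0))
            (.seq (learn 8) (learn 9))))))
    (.assign 7 (.const 0))

/-- Scan the pairs until one prevents the insertion of the vertex in register `6`. -/
def scan : Prog := .seq (.assign 7 (.const 1)) (.loop (.reg 7) scanStep)

/-- If the vertex in register `12` is a median of the unknown in-neighbours of the vertex in
register `6`, probe their edge and draw the conclusions. -/
def searchStep : Prog :=
  .cond (unknown (.reg 12))
    (.seq (.sumLoop 14 13 (unknown (.reg 13)))
      (.seq (.sumLoop 15 13 (both (unknown (.reg 13)) (.entry 4 (.reg 13) (.reg 12))))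
        (.cond (.add (.sub (.reg 14) (.add (.reg 15) (.reg 15)))
            (.sub (.add (.reg 15) (.reg 15)) (.add (.reg 14) (.const 1))))
          .skip
          (.seq (.probe 10 (.reg 12) (.reg 6))
            (.cond (.reg 10)
              (.forLoop 13 (.cond (both (unknown (.reg 13)) (.entry 4 (.reg 13) (.reg 12)))
                (.store 3 (.reg 13) (.reg 6) (.const 1)) .skip))
              (.forLoop 13 (.cond (both (unknown (.reg 13)) (.entry 4 (.reg 12) (.reg 13)))
                (.store 3 (.reg 6) (.reg 13) (.const 1)) .skip)))))))
    .skip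

/-- Determine the directions of all edges between the vertex in register `6` and the inserted
vertices. -/
def search : Prog := .forLoop 11 (.forLoop 12 searchStep)

/-- Mark in a row of table `5` the vertex in register `6` and all vertices with a nonzero sum. -/
def mark (row : ℕ) (e : Expr) : Prog :=
  .forLoop 11 (.seq (.sumLoop 14 13 e)
    (.store 5 (.const row) (.reg 11) (.add (.reg 14)
      (neg (.add (.sub (.reg 11) (.reg 6)) (.sub (.reg 6) (.reg 11)))))))

/-- Insert the vertex in register `6` into the reachability relation. -/
def insert : Prog :=
  .seq (mark 1 (both (.entry 4 (.reg 11) (.reg 13)) (.entry 3 (.reg 13) (.reg 6))))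
    (.seq (mark 2 (both (.entry 3 (.reg 6) (.reg 13)) (.entry 4 (.reg 13) (.reg 11))))
      (.forLoop 11 (.forLoop 12 (.cond (.entry 5 (.const 1) (.reg 11))
        (.cond (.entry 5 (.const 2) (.reg 12)) (.store 4 (.reg 11) (.reg 12) (.const 1)) .skip)
        .skip))))

/-- Attempt to insert the vertex in register `6`. -/
def attempt : Prog :=
  .cond (.entry 4 (.reg 6) (.reg 6)) .skip
    (.seq scan (.cond (.sub (.reg 1) position) .skip (.seq search insert)))

/-- Insert all vertices. -/
def insertAll : Prog := .forLoop 5 (.forLoop 6 attempt)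

/-- Write the output. -/
def output : Prog :=
  .forLoop 6 (.seq (.sumLoop 14 13 (.entry 4 (.reg 13) (.reg 6)))
    (.store 1 (.const 0) (.sub (.reg 14) (.const 1)) (.reg 6)))

/-- List all pairs of vertices in table `2`, and count them in register `1`. -/
def listPairs : Prog :=
  .seq (.assign 1 (.const 0))
    (.forLoop 5 (.forLoop 6 (.seq (.store 2 (.const 0) (.reg 1) (.reg 5))
      (.seq (.store 2 (.const 1) (.reg 1) (.reg 6)) (.assign 1 (.add (.reg 1) (.const 1)))))))

/-- Exchange the entries number `i` and `i + k` of a row of table `2`, for `i` in register `3` and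
`k` in register `2`. -/
def exchange (row : ℕ) : Prog :=
  .seq (.assign 4 (.entry 2 (.const row) (.reg 3)))
    (.seq (.store 2 (.const row) (.reg 3) (.entry 2 (.const row) (.add (.reg 3) (.reg 2))))
      (.store 2 (.const row) (.add (.reg 3) (.reg 2)) (.reg 4)))

/-- The deterministic part of a step of the random permutation. -/
def shuffleStep : Prog :=
  .seq (exchange 0) (.seq (exchange 1) (.assign 3 (.add (.reg 3) (.const 1))))

/-- Permute the pairs at random. -/
def shuffle : Prog :=
  .seq (.assign 3 (.const 0))
    (.loop (.sub (.reg 1) (.reg 3))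
      (.seq (.draw 2 (.sub (.sub (.reg 1) (.reg 3)) (.const 1))) shuffleStep))

/-- The sorting program. -/
def main : Prog := .seq listPairs (.seq shuffle (.seq insertAll output))

end SortProg

/-! ### Correctness of the deterministic part -/

open Classical in
/-- The truth value of a proposition as a number. -/
noncomputable def ind (p : Prop) : ℕ := if p then 1 else 0

theorem ind_pos {p : Prop} (h : p) : ind p = 1 := if_pos h

theorem ind_neg {p : Prop} (h : ¬ p) : ind p = 0 := if_neg h

theorem ind_eq_zero {p : Prop} : ind p = 0 ↔ ¬ p := by
  by_cases h : p <;> simp [ind, h]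

theorem sum_ind (n : ℕ) (p : ℕ → Prop) [DecidablePred p] :
    ∑ i ∈ Finset.range n, ind (p i) = ((Finset.range n).filter p).card := by
  rw [Finset.card_filter]
  refine Finset.sum_congr rfl fun i _ => ?_
  by_cases h : p i <;> simp [ind, h]

namespace PathInstance

/-- The memory represents the state of the algorithm. -/
structure Rep (I : PathInstance) (a : ℕ → ℕ × ℕ) (R K : ℕ → ℕ → Prop) (ptr : ℕ → ℕ)
    (s : Mem) : Prop where
  n_eq : s.regs 0 = I.n
  size_eq : s.regs 1 = I.n * I.n
  predicted : ∀ x y, s.tabs 0 x y = ind (I.P x y)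
  pairs : ∀ j, a j = (s.tabs 2 0 j, s.tabs 2 1 j)
  arcs : ∀ x y, s.tabs 3 x y = ind (K x y)
  reach : ∀ x y, s.tabs 4 x y = ind (R x y)
  position : ∀ x, s.tabs 5 0 x = ptr x

variable {I : PathInstance} {a : ℕ → ℕ × ℕ} {R K : ℕ → ℕ → Prop} {ptr : ℕ → ℕ} {s : Mem}

theorem Rep.congr (h : I.Rep a R K ptr s) {s' : Mem} (h0 : s'.regs 0 = s.regs 0)
    (h1 : s'.regs 1 = s.regs 1) (ht : s'.tabs = s.tabs) : I.Rep a R K ptr s' := by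
  obtain ⟨c1, c2, c3, c4, c5, c6, c7⟩ := h
  exact ⟨h0.trans c1, h1.trans c2, by rwa [ht], by rwa [ht], by rwa [ht], by rwa [ht], by rwa [ht]⟩

theorem Rep.setReg (h : I.Rep a R K ptr s) {x : ℕ} (b : ℕ) (hx : 2 ≤ x) :
    I.Rep a R K ptr (s.setReg x b) :=
  h.congr (by rw [Mem.regs_setReg, if_neg (by omega)]) (by rw [Mem.regs_setReg, if_neg (by omega)])
    rfl

theorem Rep.setArc (h : I.Rep a R K ptr s) (b c : ℕ) :
    I.Rep a R (fun x y => K x y ∨ x = b ∧ y = c) ptr (s.setEntry 3 b c 1) := by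
  obtain ⟨c1, c2, c3, c4, c5, c6, c7⟩ := h
  refine ⟨c1, c2, ?_, ?_, ?_, ?_, ?_⟩ <;> intros <;> simp only [Mem.tabs_setEntry]
  · simpa using c3 _ _
  · simpa using c4 _
  · rw [c5]
    unfold ind
    split_ifs <;> simp_all
  · simpa using c6 _ _
  · simpa using c7 _

theorem Rep.setReach (h : I.Rep a R K ptr s) (b c : ℕ) :
    I.Rep a (fun x y => R x y ∨ x = b ∧ y = c) K ptr (s.setEntry 4 b c 1) := by
  obtain ⟨c1, c2, c3, c4, c5, c6, c7⟩ := h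
  refine ⟨c1, c2, ?_, ?_, ?_, ?_, ?_⟩ <;> intros <;> simp only [Mem.tabs_setEntry]
  · simpa using c3 _ _
  · simpa using c4 _
  · simpa using c5 _ _
  · rw [c6]
    unfold ind
    split_ifs <;> simp_all
  · simpa using c7 _

theorem Rep.setPosition (h : I.Rep a R K ptr s) (b c : ℕ) :
    I.Rep a R K (Function.update ptr b c) (s.setEntry 5 0 b c) := by
  obtain ⟨c1, c2, c3, c4, c5, c6, c7⟩ := h
  refine ⟨c1, c2, ?_, ?_, ?_, ?_, ?_⟩ <;> intros <;> simp only [Mem.tabs_setEntry]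
  · simpa using c3 _ _
  · simpa using c4 _
  · simpa using c5 _ _
  · simpa using c6 _ _
  · simp [Function.update_apply, c7]

theorem Rep.setOther (h : I.Rep a R K ptr s) {t i : ℕ} (j b : ℕ) (ht : t = 1 ∨ t = 5 ∧ i ≠ 0) :
    I.Rep a R K ptr (s.setEntry t i j b) := by
  obtain ⟨c1, c2, c3, c4, c5, c6, c7⟩ := h
  refine ⟨c1, c2, ?_, ?_, ?_, ?_, ?_⟩ <;> intros <;> simp only [Mem.tabs_setEntry]
  · rw [if_neg (by omega)]; exact c3 _ _
  · rw [if_neg (by omega), if_neg (by omega)]; exact c4 _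
  · rw [if_neg (by omega)]; exact c5 _ _
  · rw [if_neg (by omega)]; exact c6 _ _
  · rw [if_neg (by omega)]; exact c7 _

theorem Rep.eval_unknown (h : I.Rep a R K ptr s) {regs : ℕ → ℕ} {u : ℕ} (hu : regs 6 = u)
    (y : Expr) : (SortProg.unknown y).eval regs s.tabs =
      ind (I.Unknown K u (y.eval regs s.tabs)) := by
  simp only [SortProg.unknown, SortProg.both, SortProg.neg, Expr.eval, h.predicted, h.arcs, hu,
    Unknown]
  generalize y.eval regs s.tabs = z
  by_cases h1 : I.P z u <;> by_cases h2 : K z u <;> by_cases h3 : K u z <;>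
    simp [ind, h1, h2, h3]

theorem eval_both {regs : ℕ → ℕ} {tabs : ℕ → ℕ → ℕ → ℕ} {e f : Expr} {p q : Prop}
    (he : e.eval regs tabs = ind p) (hf : f.eval regs tabs = ind q) :
    (SortProg.both e f).eval regs tabs = ind (p ∧ q) := by
  simp only [SortProg.both, Expr.eval, he, hf]
  by_cases h1 : p <;> by_cases h2 : q <;> simp [ind, h1, h2]

/-! ### Correctness of probing and scanning -/

variable {M : ℕ} {u : ℕ}

theorem wp_learn {x z : ℕ} {Q : Mem → Prop} (h : I.Rep a R K ptr s) (hx : s.regs x = z)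
    (hx10 : x ≠ 10) (hu : s.regs 6 = u) (hP : I.P z u)
    (hQ : ∀ s', I.Rep a R (I.learn K z u) ptr s' → (∀ y ≠ 10, s'.regs y = s.regs y) →
      s'.probes = s.probes + 1 → Q s') :
    (SortProg.learn x).WP I.oracle M Q s := by
  classical
  refine .seq (.probe (b := decide (I.H z u)) ?_ ?_)
  · simp only [Mem.value_reg, hx, hu, I.oracle_eq hP]
  have hrep : ∀ b, I.Rep a R K ptr (s.probed.setReg 10 b) := fun b =>
    Rep.setReg (h.congr (s' := s.probed) rfl rfl rfl) b (by norm_num)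
  refine .cond (fun hc => ?_) (fun hc => ?_)
  · have hH : I.H z u := by simpa using hc
    refine .store (hQ _ ?_ ?_ rfl)
    · simp only [Mem.value_reg, Mem.value_const, Mem.regs_setReg, if_neg hx10, Mem.regs_probed, hx,
        hu]
      have heq : I.learn K z u = fun b c => K b c ∨ b = z ∧ c = u := by
        funext b c
        refine propext (or_congr_right ⟨?_, ?_⟩)
        · rintro ⟨h1, h2 | ⟨rfl, rfl⟩⟩
          · exact h2
          · exact absurd h1 (I.H_asymm hH)
        · rintro ⟨rfl, rfl⟩
          exact ⟨hH, Or.inl ⟨rfl, rfl⟩⟩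
      rw [heq]
      exact (hrep _).setArc z u
    · intro y hy
      simp [hy]
  · have hH : ¬ I.H z u := by simpa using hc
    have hH' : I.H u z := (I.P_edge hP).resolve_left hH
    refine .store (hQ _ ?_ ?_ rfl)
    · simp only [Mem.value_reg, Mem.value_const, Mem.regs_setReg, if_neg hx10, Mem.regs_probed, hx,
        hu]
      have heq : I.learn K z u = fun b c => K b c ∨ b = u ∧ c = z := by
        funext b c
        refine propext (or_congr_right ⟨?_, ?_⟩)
        · rintro ⟨h1, ⟨rfl, rfl⟩ | h2⟩
          · exact absurd h1 hH
          · exact h2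
        · rintro ⟨rfl, rfl⟩
          exact ⟨hH', Or.inr ⟨rfl, rfl⟩⟩
      rw [heq]
      exact (hrep _).setArc u z
    · intro y hy
      simp [hy]

theorem Rep.value_dead (h : I.Rep a R K ptr s) (hu : s.regs 6 = u) :
    s.value SortProg.dead = 0 ↔ ¬ I.Dead R K u (s.regs 8, s.regs 9) := by
  simp only [SortProg.dead, SortProg.neg, Mem.value_add, Mem.value_sub, Mem.value_const,
    Mem.value_entry, Mem.value_reg, h.predicted, h.arcs, h.reach, hu, Dead, Cmp]
  have hle : ∀ p, 1 - ind p = 0 ↔ p := fun p => by by_cases hp : p <;> simp [ind, hp]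
  simp only [Nat.add_eq_zero_iff, hle, ind_eq_zero]
  tauto

/-- The memory is in the loops with indices `r` and `u`, and represents the state after `t`
attempts. -/
def ScanState (I : PathInstance) (a : ℕ → ℕ × ℕ) (t r u : ℕ) (K : ℕ → ℕ → Prop) (ptr : ℕ → ℕ)
    (s : Mem) : Prop :=
  s.regs 5 = r ∧ s.regs 6 = u ∧ I.Rep a (I.rel t) K ptr s ∧ I.Inv a t K ptr s.probes 0

theorem wp_scan {t r : ℕ} (hM : 3 * (I.n * I.n) + 2 ≤ M) (ht : t < I.n * I.n)
    (h : I.ScanState a t r u K ptr s) :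
    SortProg.scan.WP I.oracle M (fun s' => ∃ K' ptr', I.ScanState a t r u K' ptr' s' ∧
      (ptr' u = I.n * I.n ∨ ptr' u < I.n * I.n ∧ ¬ I.Ideal (I.rel t) u)) s := by
  classical
  -- `c` is `0` once both edges of the current pair have known directions. Probing lowers it from
  -- `1` to `0`; advancing may reset it to `1`, but lowers the main term of the variant by `3`.
  let c : Mem → ℕ := fun s =>
    if s.tabs 3 (s.tabs 2 0 (s.tabs 5 0 u)) u + s.tabs 3 u (s.tabs 2 0 (s.tabs 5 0 u)) ≠ 0 ∧
      s.tabs 3 (s.tabs 2 1 (s.tabs 5 0 u)) u + s.tabs 3 u (s.tabs 2 1 (s.tabs 5 0 u)) ≠ 0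
    then 0 else 1
  have hc : ∀ s, c s ≤ 1 := fun s => by simp only [c]; split_ifs <;> omega
  refine .seq (.assign (.loop (fun s => ∃ K ptr, I.ScanState a t r u K ptr s ∧
    (s.regs 7 = 0 → ptr u = I.n * I.n ∨ ptr u < I.n * I.n ∧ ¬ I.Ideal (I.rel t) u))
    (fun s => if s.regs 7 = 0 then 0 else 1 + 3 * (I.n * I.n - s.tabs 5 0 u) + c s)
    ?_ ?_ ?_ ?_))
  · refine ⟨K, ptr, ⟨?_, ?_, h.2.2.1.setReg _ (by norm_num), h.2.2.2⟩, ?_⟩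
    · simpa using h.1
    · simpa using h.2.1
    · simp
  · have := hc (s.setReg 7 (s.value (.const 1)))
    simp only [Mem.regs_setReg, if_true, Mem.value_const, one_ne_zero, if_false,
      Mem.tabs_setReg] at this ⊢
    omega
  · rintro s ⟨K, ptr, ⟨h5, h6, hrep, hinv⟩, -⟩ h7
    simp only [Mem.value_reg] at h7
    have hpos : s.value SortProg.position = ptr u := by
      simp [SortProg.position, h6, hrep.position]
    have hle := hinv.ptr_le u
    have hhold : ∀ s' : Mem, (∀ y, y ≠ 7 → y ≠ 8 → y ≠ 9 → s'.regs y = s.regs y) →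
        s'.tabs = s.tabs → s'.probes = s.probes →
        (ptr u = I.n * I.n ∨ ptr u < I.n * I.n ∧ ¬ I.Ideal (I.rel t) u) →
        (Prog.assign 7 (.const 0)).WP I.oracle M (fun s' => (∃ K ptr,
          I.ScanState a t r u K ptr s' ∧ (s'.regs 7 = 0 →
            ptr u = I.n * I.n ∨ ptr u < I.n * I.n ∧ ¬ I.Ideal (I.rel t) u)) ∧
          (if s'.regs 7 = 0 then 0 else 1 + 3 * (I.n * I.n - s'.tabs 5 0 u) + c s') <
            if s.regs 7 = 0 then 0 else 1 + 3 * (I.n * I.n - s.tabs 5 0 u) + c s) s' := by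
      intro s' hr ht hp hfin
      refine .assign ⟨⟨K, ptr, ⟨?_, ?_, ?_, ?_⟩, fun _ => hfin⟩, ?_⟩
      · simp [hr, h5]
      · simp [hr, h6]
      · exact hrep.congr (by simp [hr]) (by simp [hr]) ht
      · rw [Mem.probes_setReg, hp]
        exact hinv
      · simp only [Mem.regs_setReg, if_true, Mem.value_const, h7, if_false]
        omega
    refine .cond (fun hv => ?_) (fun hv => ?_)
    · simp only [Mem.value_sub, Mem.value_reg, hrep.size_eq, hpos] at hv
      have hlt : ptr u < I.n * I.n := by omega
      refine .seq (.assign (.seq (.assign ?_)))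
      have hv8 : s.value (.entry 2 (.const 0) SortProg.position) = (a (ptr u)).1 := by
        simp [hpos, hrep.pairs]
      have hv9 : (s.setReg 8 (s.value (.entry 2 (.const 0) SortProg.position))).value
          (.entry 2 (.const 1) SortProg.position) = (a (ptr u)).2 := by
        simp [SortProg.position, h6, hrep.position, hrep.pairs]
      rw [hv9, hv8]
      set s2 := (s.setReg 8 (a (ptr u)).1).setReg 9 (a (ptr u)).2 with hs2
      have hrep2 : I.Rep a (I.rel t) K ptr s2 :=
        (hrep.setReg _ (by norm_num)).setReg _ (by norm_num)
      have h52 : s2.regs 5 = r := by simp [hs2, h5]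
      have h62 : s2.regs 6 = u := by simp [hs2, h6]
      have h72 : s2.regs 7 ≠ 0 := by simpa [hs2] using h7
      have h82 : s2.regs 8 = (a (ptr u)).1 := by simp [hs2]
      have h92 : s2.regs 9 = (a (ptr u)).2 := by simp [hs2]
      have ht2 : s2.tabs = s.tabs := rfl
      have hp2 : s2.probes = s.probes := rfl
      have hdead := hrep2.value_dead h62
      rw [h82, h92] at hdead
      refine .cond (fun hd => ?_) (fun hd => ?_)
      · have hd' : I.Dead (I.rel t) K u (a (ptr u)) := by
          by_contra hcon
          exact hd (hdead.2 hcon)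
        refine .store ?_
        have hv2 : s2.value (.add SortProg.position (.const 1)) = ptr u + 1 := by
          simp [SortProg.position, h62, hrep2.position]
        rw [hv2]
        simp only [Mem.value_const, Mem.value_reg, h62]
        refine ⟨⟨K, _, ⟨h52, h62, hrep2.setPosition u (ptr u + 1), hinv.advance hlt hd'⟩,
          fun h => absurd h h72⟩, ?_⟩
        have := hc (s2.setEntry 5 0 u (ptr u + 1))
        rw [if_neg (by simpa using h72), if_neg h7]
        rw [hrep.position]
        simp only [Mem.tabs_setEntry, and_self, if_true]
        omega
      · have hd' := hdead.1 hd
        have hboth : (SortProg.both (.entry 3 (.reg 8) (.reg 6)) (.entry 3 (.reg 9) (.reg 6))).eval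
            s2.regs s2.tabs = ind (K (a (ptr u)).1 u ∧ K (a (ptr u)).2 u) := by
          refine eval_both ?_ ?_ <;> simp [Expr.eval, h62, h82, h92, hrep2.arcs]
        refine .cond (fun hb => ?_) (fun hb => ?_)
        · simp only [Mem.value] at hb
          rw [hboth, ne_eq, ind_eq_zero, not_not] at hb
          refine hhold s2 ?_ ht2 hp2 (Or.inr ⟨hlt, hinv.not_ideal hd' hb.1 hb.2⟩)
          intro y h1 h2 h3
          simp [hs2, h2, h3]
        · simp only [Mem.value] at hb
          rw [hboth, ind_eq_zero] at hb
          have hd'' := hd'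
          unfold Dead at hd''
          push Not at hd''
          obtain ⟨hP1, hP2, hK1, hK2, -⟩ := hd''
          refine .seq (wp_learn hrep2 h82 (by norm_num) h62 hP1 fun s3 hrep3 hr3 hp3 => ?_)
          refine wp_learn hrep3 (z := (a (ptr u)).2) (by rw [hr3 9 (by norm_num), h92])
            (by norm_num) (by rw [hr3 6 (by norm_num), h62]) hP2 fun s4 hrep4 hr4 hp4 => ?_
          have hr42 : ∀ y ≠ 10, s4.regs y = s2.regs y := fun y hy => (hr4 y hy).trans (hr3 y hy)
          have hp42 : s4.probes = s.probes + 2 := by rw [hp4, hp3, hp2]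
          refine ⟨⟨_, ptr, ⟨?_, ?_, hrep4, ?_⟩, fun h => ?_⟩, ?_⟩
          · rw [hr42 5 (by norm_num), h52]
          · rw [hr42 6 (by norm_num), h62]
          · rw [hp42]
            exact hinv.probe ht hlt hd' hb
          · rw [hr42 7 (by norm_num)] at h
            exact absurd h h72
          · rw [hr42 7 (by norm_num), if_neg h72, if_neg h7, hrep4.position, hrep.position]
            have hc1 : c s = 1 := by
              simp only [c, hrep.position, hrep.arcs]
              have e1 : s.tabs 2 0 (ptr u) = (a (ptr u)).1 := by rw [hrep.pairs]
              have e2 : s.tabs 2 1 (ptr u) = (a (ptr u)).2 := by rw [hrep.pairs]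
              rw [e1, e2, ind_neg hK1, ind_neg hK2, if_neg]
              rintro ⟨g1, g2⟩
              rw [add_zero, ne_eq, ind_eq_zero, not_not] at g1 g2
              exact hb ⟨g1, g2⟩
            have hc4 : c s4 = 0 := by
              simp only [c, hrep4.position, hrep4.arcs]
              have e1 : s4.tabs 2 0 (ptr u) = (a (ptr u)).1 := by rw [hrep4.pairs]
              have e2 : s4.tabs 2 1 (ptr u) = (a (ptr u)).2 := by rw [hrep4.pairs]
              rw [e1, e2, if_pos]
              constructor
              · rcases learn_known (K := K) hP1 with h | h
                · rw [ind_pos (learn_mono _ _ _ _ h)]; omega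
                · rw [ind_pos (p := I.learn (I.learn K _ u) _ u u _) (learn_mono _ _ _ _ h)]; omega
              · rcases learn_known (K := I.learn K (a (ptr u)).1 u) hP2 with h | h
                · rw [ind_pos h]; omega
                · rw [ind_pos (p := I.learn (I.learn K _ u) _ u u _) h]; omega
            omega
    · simp only [Mem.value_sub, Mem.value_reg, hrep.size_eq, hpos] at hv
      exact hhold s (fun _ _ _ _ => rfl) rfl rfl (Or.inl (by omega))
  · rintro s ⟨K, ptr, h, hfin⟩ h7
    exact ⟨K, ptr, h, hfin h7⟩

end PathInstance

/-! ### Correctness of the binary search -/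

namespace PathInstance

variable {I : PathInstance} {a : ℕ → ℕ × ℕ} {R K : ℕ → ℕ → Prop} {ptr : ℕ → ℕ} {s : Mem}
  {M u : ℕ}

/-- A loop that records, for a predicate `A` on the indices, arcs given by `arc`. -/
theorem wp_concludeLoop {e i j : Expr} {Q : Mem → Prop} {arc : ℕ → ℕ × ℕ} {A : ℕ → Prop}
    (hM : I.n ≤ M) (h : I.Rep a R K ptr s)
    (he : ∀ y s', y < I.n → (∀ z ≠ 13, s'.regs z = s.regs z) → s'.regs 13 = y →
      I.Rep a R (fun b c => K b c ∨ ∃ z < y, A z ∧ (b, c) = arc z) ptr s' →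
      s'.value e = ind (A y) ∧ (s'.value i, s'.value j) = arc y)
    (hQ : ∀ s', (∀ z ≠ 13, s'.regs z = s.regs z) → s'.probes = s.probes →
      I.Rep a R (fun b c => K b c ∨ ∃ z < I.n, A z ∧ (b, c) = arc z) ptr s' → Q s') :
    (Prog.forLoop 13 (.cond e (.store 3 i j (.const 1)) .skip)).WP I.oracle M Q s := by
  refine .forLoop (n := I.n) (fun y s' => (∀ z ≠ 13, s'.regs z = s.regs z) ∧
    s'.probes = s.probes ∧
    I.Rep a R (fun b c => K b c ∨ ∃ z < y, A z ∧ (b, c) = arc z) ptr s') (by norm_num) hM h.n_eq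
    ?_ ?_ ?_
  · refine ⟨fun z hz => by simp [hz], rfl, ?_⟩
    simpa using h.setReg 0 (x := 13) (by norm_num)
  · rintro y s' hy h0 h13 ⟨hr, hp, hrep⟩
    obtain ⟨hv, harc⟩ := he y s' hy hr h13 hrep
    refine .cond (fun hc => .store ?_) (fun hc => .skip ?_)
    · rw [hv, ne_eq, ind_eq_zero, not_not] at hc
      refine ⟨h0, h13, fun z hz => by simp [hz, hr], hp, Rep.setReg ?_ _ (by norm_num)⟩
      have := hrep.setArc (s'.value i) (s'.value j)
      rw [Mem.value_const]
      convert this using 1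
      funext b c
      refine propext ?_
      rw [or_assoc]
      refine or_congr_right ?_
      have harc1 : s'.value i = (arc y).1 := by rw [← harc]
      have harc2 : s'.value j = (arc y).2 := by rw [← harc]
      rw [harc1, harc2, ← Prod.ext_iff (x := (b, c))]
      constructor
      · rintro ⟨z, hz, hA, hz'⟩
        rcases Nat.lt_succ_iff_lt_or_eq.1 hz with hz | rfl
        · exact Or.inl ⟨z, hz, hA, hz'⟩
        · exact Or.inr hz'
      · rintro (⟨z, hz, hA, hz'⟩ | hz)
        · exact ⟨z, by omega, hA, hz'⟩
        · exact ⟨y, by omega, hc, hz⟩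
    · rw [hv, ind_eq_zero] at hc
      refine ⟨h0, h13, fun z hz => by simp [hz, hr], hp, Rep.setReg ?_ _ (by norm_num)⟩
      convert hrep using 1
      funext b c
      refine propext (or_congr_right ⟨?_, ?_⟩)
      · rintro ⟨z, hz, hA, hz'⟩
        rcases Nat.lt_succ_iff_lt_or_eq.1 hz with hz | rfl
        · exact ⟨z, hz, hA, hz'⟩
        · exact absurd hA hc
      · rintro ⟨z, hz, hA, hz'⟩
        exact ⟨z, by omega, hA, hz'⟩
  · rintro s' _ ⟨hr, hp, hrep⟩
    exact hQ s' hr hp hrep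

theorem wp_searchStep {m : ℕ} {Q : Mem → Prop} (hM : I.n ≤ M) (h : I.Rep a R K ptr s)
    (hu : s.regs 6 = u) (hm : s.regs 12 = m)
    (hno : ¬ I.IsMedian R K u m → ∀ s', (∀ z, z ≠ 13 → z ≠ 14 → z ≠ 15 → s'.regs z = s.regs z) →
      s'.probes = s.probes → I.Rep a R K ptr s' → Q s')
    (hyes : I.IsMedian R K u m → ∀ s', (∀ z, z ≠ 10 → z ≠ 13 → z ≠ 14 → z ≠ 15 →
      s'.regs z = s.regs z) → s'.probes = s.probes + 1 →
      I.Rep a R (I.conclude R K u m) ptr s' → Q s') :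
    SortProg.searchStep.WP I.oracle M Q s := by
  classical
  have hunk := h.eval_unknown hu (.reg 12)
  simp only [Expr.eval, hm] at hunk
  refine .cond (fun hc => ?_) (fun hc => .skip ?_)
  · simp only [Mem.value] at hc
    rw [hunk, ne_eq, ind_eq_zero, not_not] at hc
    refine .seq (.sumLoop (n := I.n) (fun y => ind (I.Unknown K u y)) (by norm_num) (by norm_num)
      (by norm_num) hM h.n_eq ?_ ?_)
    · intro y regs hr hy _
      rw [h.eval_unknown (by rw [hr 6 (by norm_num) (by norm_num), hu])]
      simp [Expr.eval, hy]
    intro regs hr hcnt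
    rw [sum_ind] at hcnt
    have h1 : I.Rep a R K ptr ⟨regs, s.tabs, s.probes⟩ :=
      h.congr (hr 0 (by norm_num) (by norm_num)) (hr 1 (by norm_num) (by norm_num)) rfl
    refine .seq (.sumLoop (n := I.n) (fun y => ind (I.Unknown K u y ∧ R y m)) (by norm_num)
      (by norm_num) (by norm_num) hM h1.n_eq ?_ ?_)
    · intro y regs' hr' hy _
      refine eval_both ?_ ?_
      · rw [h1.eval_unknown (u := u) ((hr' 6 (by norm_num) (by norm_num)).trans
          ((hr 6 (by norm_num) (by norm_num)).trans hu))]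
        simp [Expr.eval, hy]
      · simp only [Expr.eval, hy]
        rw [hr' 12 (by norm_num) (by norm_num)]
        simp only
        rw [hr 12 (by norm_num) (by norm_num), hm]
        exact h.reach y m
    intro regs' hr' hrk
    rw [sum_ind] at hrk
    simp only at hr'
    have hr2 : ∀ z, z ≠ 13 → z ≠ 14 → z ≠ 15 → regs' z = s.regs z := fun z z1 z2 z3 =>
      (hr' z z3 z1).trans (hr z z2 z1)
    have h2 : I.Rep a R K ptr ⟨regs', s.tabs, s.probes⟩ :=
      h.congr (hr2 0 (by norm_num) (by norm_num) (by norm_num))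
        (hr2 1 (by norm_num) (by norm_num) (by norm_num)) rfl
    have hcnt' : regs' 14 = (I.unknowns K u).card := by
      rw [hr' 14 (by norm_num) (by norm_num), hcnt]
      rfl
    have hrk' : regs' 15 = I.rank R K u m := by
      rw [hrk, rank, unknowns, Finset.filter_filter]
    have hu2 := (hr2 6 (by norm_num) (by norm_num) (by norm_num)).trans hu
    have hm2 := (hr2 12 (by norm_num) (by norm_num) (by norm_num)).trans hm
    -- Both truncated differences vanish precisely when the two inequalities of `IsMedian` hold.
    refine .cond (fun hv => .skip ?_) (fun hv => .seq (.probe (b := decide (I.H m u)) ?_ ?_))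
    · refine hno (fun hmed => hv ?_) _ hr2 rfl h2
      have := hmed.2
      simp only [Mem.value_add, Mem.value_sub, Mem.value_reg, Mem.value_const, hcnt', hrk']
      omega
    · simp only [Mem.value_reg, hm2, hu2, I.oracle_eq hc.1]
    have hmed : I.IsMedian R K u m := by
      simp only [Mem.value_add, Mem.value_sub, Mem.value_reg, Mem.value_const, hcnt', hrk'] at hv
      exact ⟨hc, by omega, by omega⟩
    set s3 := Mem.setReg (Mem.probed ⟨regs', s.tabs, s.probes⟩) 10
      (if decide (I.H m u) = true then 1 else 0) with hs3
    have h2' : I.Rep a R K ptr (Mem.probed ⟨regs', s.tabs, s.probes⟩) := h2.congr rfl rfl rfl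
    have h3 : I.Rep a R K ptr s3 := h2'.setReg _ (by norm_num)
    have hr3 : ∀ z, z ≠ 10 → z ≠ 13 → z ≠ 14 → z ≠ 15 → s3.regs z = s.regs z := by
      intro z z1 z2 z3 z4
      simp only [hs3, Mem.regs_setReg, if_neg z1]
      exact hr2 z z2 z3 z4
    have hu3 := (hr3 6 (by norm_num) (by norm_num) (by norm_num) (by norm_num)).trans hu
    have hm3 := (hr3 12 (by norm_num) (by norm_num) (by norm_num) (by norm_num)).trans hm
    have hp3 : s3.probes = s.probes + 1 := rfl
    refine .cond (fun hv => ?_) (fun hv => ?_)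
    · have hH : I.H m u := by simpa [hs3] using hv
      refine wp_concludeLoop (A := fun y => I.Unknown K u y ∧ R y m) (arc := fun y => (y, u)) hM h3
        ?_ ?_
      · intro y s' hy hr' hy' hrep'
        have hu' := (hr' 6 (by norm_num)).trans hu3
        refine ⟨eval_both ?_ ?_, by simp [hy', hu']⟩
        · rw [hrep'.eval_unknown hu']
          simp only [Expr.eval, hy']
          congr 1
          -- The table of arcs changes during the loop, but the arcs stored so far belong to indices
          -- below `y` and do not affect whether `y` is unknown.
          refine propext (and_congr_right fun _ => ?_)
          simp only [Prod.mk.injEq]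
          constructor
          · exact fun h => ⟨fun h' => h.1 (Or.inl h'), fun h' => h.2 (Or.inl h')⟩
          · refine fun h => ⟨?_, ?_⟩
            · rintro (h' | ⟨z, hz, -, rfl, -⟩)
              · exact h.1 h'
              · omega
            · rintro (h' | ⟨z, hz, -, rfl, rfl⟩)
              · exact h.2 h'
              · omega
        · simp only [Expr.eval, hy', hr' 12 (by norm_num), hm3, hrep'.reach]
      · intro s' hr' hp' hrep'
        refine hyes hmed s' (fun z z1 z2 z3 z4 => (hr' z z2).trans (hr3 z z1 z2 z3 z4))
          (hp'.trans hp3) ?_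
        convert hrep' using 1
        funext b c
        refine propext (or_congr_right ?_)
        simp only [Prod.mk.injEq]
        constructor
        · rintro (⟨h1, h2, h3, h4⟩ | ⟨h1, -⟩)
          · exact ⟨b, (I.P_lt h3.1).1, ⟨h3, h4⟩, rfl, h2⟩
          · exact absurd h1 (I.H_asymm hH)
        · rintro ⟨z, -, ⟨h3, h4⟩, rfl, rfl⟩
          exact Or.inl ⟨hH, rfl, h3, h4⟩
    · have hH : ¬ I.H m u := by simpa [hs3] using hv
      have hH' : I.H u m := (I.P_edge hc.1).resolve_left hH
      refine wp_concludeLoop (A := fun y => I.Unknown K u y ∧ R m y) (arc := fun y => (u, y)) hM h3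
        ?_ ?_
      · intro y s' hy hr' hy' hrep'
        have hu' := (hr' 6 (by norm_num)).trans hu3
        refine ⟨eval_both ?_ ?_, by simp [hy', hu']⟩
        · rw [hrep'.eval_unknown hu']
          simp only [Expr.eval, hy']
          congr 1
          refine propext (and_congr_right fun _ => ?_)
          simp only [Prod.mk.injEq]
          constructor
          · exact fun h => ⟨fun h' => h.1 (Or.inl h'), fun h' => h.2 (Or.inl h')⟩
          · refine fun h => ⟨?_, ?_⟩
            · rintro (h' | ⟨z, hz, -, rfl, rfl⟩)
              · exact h.1 h'
              · omega
            · rintro (h' | ⟨z, hz, -, -, rfl⟩)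
              · exact h.2 h'
              · omega
        · simp only [Expr.eval, hy', hr' 12 (by norm_num), hm3, hrep'.reach]
      · intro s' hr' hp' hrep'
        refine hyes hmed s' (fun z z1 z2 z3 z4 => (hr' z z2).trans (hr3 z z1 z2 z3 z4))
          (hp'.trans hp3) ?_
        convert hrep' using 1
        funext b c
        refine propext (or_congr_right ?_)
        simp only [Prod.mk.injEq]
        constructor
        · rintro (⟨h1, -⟩ | ⟨h1, h2, h3, h4⟩)
          · exact absurd h1 hH
          · exact ⟨c, (I.P_lt h3.1).1, ⟨h3, h4⟩, h2, rfl⟩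
        · rintro ⟨z, -, ⟨h3, h4⟩, rfl, rfl⟩
          exact Or.inr ⟨hH', rfl, h3, h4⟩
  · simp only [Mem.value] at hc
    rw [hunk, ind_eq_zero] at hc
    exact hno (fun hmed => hc hmed.1) s (fun _ _ _ _ => rfl) rfl h

/-- Each pass over all vertices meets a median if any unknown is left, so it settles at least one,
and `n` passes suffice. Passes cost time only; probes are counted by halvings through `SearchInv`.
-/
theorem wp_search {t r : ℕ} {Q : Mem → Prop} (hM : I.n ≤ M) (ht : t ≤ I.n * I.n)
    (h : I.Rep a (I.rel t) K ptr s) (h5 : s.regs 5 = r) (hu : s.regs 6 = u)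
    (hs : I.SearchInv a t u K ptr s.probes)
    (hQ : ∀ K' s', I.Rep a (I.rel t) K' ptr s' → s'.regs 5 = r → s'.regs 6 = u →
      I.SearchInv a t u K' ptr s'.probes → I.unknowns K' u = ∅ → Q s') :
    SortProg.search.WP I.oracle M Q s := by
  classical
  refine .forLoop (n := I.n) (fun k s' => s'.regs 5 = r ∧ s'.regs 6 = u ∧
    ∃ K', I.Rep a (I.rel t) K' ptr s' ∧ I.SearchInv a t u K' ptr s'.probes ∧
      (I.unknowns K' u).card + k ≤ I.n) (by norm_num) hM h.n_eq ?_ ?_ ?_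
  · refine ⟨by simp [h5], by simp [hu], K, h.setReg _ (by norm_num), hs, ?_⟩
    rw [add_zero]
    exact (Finset.card_filter_le _ _).trans (Finset.card_range _).le
  · rintro k s1 hk - hk11 ⟨h51, h61, K1, hrep1, hs1, hc1⟩
    -- Within a pass, either the target of the pass has been reached or a median lies ahead at an
    -- index not yet visited.
    refine .forLoop (n := I.n) (fun m s' => s'.regs 5 = r ∧ s'.regs 6 = u ∧ s'.regs 11 = k ∧
      ∃ K', I.Rep a (I.rel t) K' ptr s' ∧ I.SearchInv a t u K' ptr s'.probes ∧
      (I.unknowns K' u).card + k ≤ I.n ∧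
      ((I.unknowns K' u).card + (k + 1) ≤ I.n ∨ ∃ m' ≥ m, I.IsMedian (I.rel t) K' u m'))
      (by norm_num) hM hrep1.n_eq ?_ ?_ ?_
    · refine ⟨by simp [h51], by simp [h61], by simp [hk11], K1, hrep1.setReg _ (by norm_num), hs1,
        hc1, ?_⟩
      rcases Finset.eq_empty_or_nonempty (I.unknowns K1 u) with hQ | hQ
      · left
        rw [hQ, Finset.card_empty]
        omega
      · right
        obtain ⟨m', hm'⟩ := exists_isMedian (I.valid_rel ht) hs1.chain hQ
        exact ⟨m', Nat.zero_le _, hm'⟩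
    · rintro m s2 hm - h12 ⟨h52, h62, hk2, K2, hrep2, hs2, hc2, hor⟩
      refine wp_searchStep hM hrep2 h62 h12 ?_ ?_
      · intro hno s3 hr3 hp3 hrep3
        refine ⟨hrep3.n_eq, ?_, ?_, ?_, ?_, K2, hrep3.setReg _ (by norm_num), ?_, hc2, ?_⟩
        · rw [hr3 12 (by norm_num) (by norm_num) (by norm_num), h12]
        · simp [hr3, h52]
        · simp [hr3, h62]
        · simp [hr3, hk2]
        · rw [Mem.probes_setReg, hp3]
          exact hs2
        · refine hor.imp_right ?_
          rintro ⟨m', hm', hmed⟩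
          refine ⟨m', ?_, hmed⟩
          rcases hm'.lt_or_eq with h | rfl
          · exact h
          · exact absurd hmed hno
      · intro hmed s3 hr3 hp3 hrep3
        have hle := card_unknowns_conclude_le hs2.chain hmed
        have hpos := Finset.card_pos.2 ⟨m, mem_unknowns.2 hmed.1⟩
        refine ⟨hrep3.n_eq, ?_, ?_, ?_, ?_, _, hrep3.setReg _ (by norm_num), ?_, by omega,
          Or.inl (by omega)⟩
        · rw [hr3 12 (by norm_num) (by norm_num) (by norm_num) (by norm_num), h12]
        · simp [hr3, h52]
        · simp [hr3, h62]
        · simp [hr3, hk2]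
        · rw [Mem.probes_setReg, hp3]
          exact hs2.conclude ht hmed
    · rintro s2 - ⟨h52, h62, hk2, K2, hrep2, hs2, hc2, hor⟩
      refine ⟨hrep2.n_eq, hk2, by simp [h52], by simp [h62], K2, hrep2.setReg _ (by norm_num), hs2,
        hor.resolve_right ?_⟩
      rintro ⟨m', hm', hmed⟩
      have := (I.P_lt hmed.1.1).1
      omega
  · rintro s1 - ⟨h51, h61, K1, hrep1, hs1, hc1⟩
    refine hQ K1 s1 hrep1 h51 h61 hs1 (Finset.card_eq_zero.1 (by omega))

/-! ### Correctness of the update of the reachability relation -/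

theorem wp_mark {row : ℕ} {e : Expr} {Q : Mem → Prop} (F : ℕ → ℕ → Prop) (hM : I.n ≤ M)
    (hrow : row ≠ 0) (h : I.Rep a R K ptr s) (hu : s.regs 6 = u)
    (he : ∀ b x regs tabs, regs 6 = u → regs 11 = b → regs 13 = x →
      (∀ y z, tabs 3 y z = ind (K y z)) → (∀ y z, tabs 4 y z = ind (R y z)) →
      e.eval regs tabs = ind (F b x))
    (hQ : ∀ s', I.Rep a R K ptr s' → (∀ y ≤ 6, s'.regs y = s.regs y) → s'.probes = s.probes →
      (∀ b < I.n, s'.tabs 5 row b = 0 ↔ ¬ (b = u ∨ ∃ x < I.n, F b x)) →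
      (∀ i b, i ≠ row → s'.tabs 5 i b = s.tabs 5 i b) → Q s') :
    (SortProg.mark row e).WP I.oracle M Q s := by
  classical
  refine .forLoop (n := I.n) (fun k s' => I.Rep a R K ptr s' ∧ (∀ y ≤ 6, s'.regs y = s.regs y) ∧
    s'.probes = s.probes ∧
    (∀ b < k, s'.tabs 5 row b = 0 ↔ ¬ (b = u ∨ ∃ x < I.n, F b x)) ∧
    (∀ i b, i ≠ row → s'.tabs 5 i b = s.tabs 5 i b)) (by norm_num) hM h.n_eq ?_ ?_ ?_
  · refine ⟨h.setReg _ (by norm_num), fun y hy => ?_, rfl, by simp, fun _ _ _ => rfl⟩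
    rw [Mem.regs_setReg, if_neg (by omega)]
  · rintro k s1 hk - h11 ⟨hrep, hr, hp, hmark, hother⟩
    have h6 := (hr 6 le_rfl).trans hu
    refine .seq (.sumLoop (n := I.n) (fun x => ind (F k x)) (by norm_num) (by norm_num)
      (by norm_num) hM hrep.n_eq ?_ ?_)
    · intro x regs hregs hx _
      refine he k x regs s1.tabs ?_ ?_ hx hrep.arcs hrep.reach
      · rw [hregs 6 (by norm_num) (by norm_num), h6]
      · rw [hregs 11 (by norm_num) (by norm_num), h11]
    · intro regs hregs hsum
      rw [sum_ind] at hsum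
      have hrep2 : I.Rep a R K ptr ⟨regs, s1.tabs, s1.probes⟩ :=
        hrep.congr (hregs 0 (by norm_num) (by norm_num)) (hregs 1 (by norm_num) (by norm_num)) rfl
      have h112 := (hregs 11 (by norm_num) (by norm_num)).trans h11
      have h62 := (hregs 6 (by norm_num) (by norm_num)).trans h6
      refine .store ?_
      simp only [Mem.value_add, Mem.value_reg, Mem.value_const, hsum, SortProg.neg, Mem.value_sub,
        h112, h62]
      refine ⟨hrep2.n_eq, h112, (hrep2.setOther _ _ (Or.inr ⟨rfl, hrow⟩)).setReg _ (by norm_num),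
        ?_, hp, ?_, ?_⟩
      · intro y hy
        simp only [Mem.regs_setReg, if_neg (show y ≠ 11 by omega), Mem.regs_setEntry]
        rw [hregs y (by omega) (by omega), hr y hy]
      · intro b hb
        simp only [Mem.tabs_setReg, Mem.tabs_setEntry, true_and]
        split_ifs with hbk
        · subst hbk
          -- The second summand is `1` minus the absolute difference of `b` and `u`, so it vanishes
          -- exactly when they differ.
          rw [Nat.add_eq_zero_iff, Finset.card_eq_zero, Finset.filter_eq_empty_iff, not_or, and_comm]
          refine and_congr ?_ ?_
          · omega
          · simp
        · exact hmark b (by omega)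
      · intro i b hi
        simp only [Mem.tabs_setReg, Mem.tabs_setEntry, hi, false_and, and_false, if_false]
        exact hother i b hi
  · rintro s1 - ⟨hrep, hr, hp, hmark, hother⟩
    exact hQ s1 hrep hr hp hmark hother

/-- The sets below and above `u` are marked before the relation is overwritten in place, so both
refer to the old `R`. -/
theorem wp_insert {r : ℕ} {Q : Mem → Prop} (hM : I.n ≤ M) (hR : I.Valid R)
    (h : I.Rep a R K ptr s) (h5 : s.regs 5 = r) (hu : s.regs 6 = u) (hun : u < I.n)
    (hK : ∀ x, R x x → (K x u ↔ I.H x u) ∧ (K u x ↔ I.H u x))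
    (hQ : ∀ s', I.Rep a (I.insertRel R u) K ptr s' → s'.regs 5 = r → s'.regs 6 = u →
      s'.probes = s.probes → Q s') :
    SortProg.insert.WP I.oracle M Q s := by
  refine .seq (wp_mark (fun b x => R b x ∧ K x u) hM (by norm_num) h hu ?_ ?_)
  · intro b x regs tabs h6 h11 h13 h3 h4
    exact eval_both (by simp [Expr.eval, h11, h13, h4]) (by simp [Expr.eval, h6, h13, h3])
  intro s1 hrep1 hr1 hp1 hmark1 _
  have hu1 := (hr1 6 le_rfl).trans hu
  refine .seq (wp_mark (fun b x => K u x ∧ R x b) hM (by norm_num) hrep1 hu1 ?_ ?_)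
  · intro b x regs tabs h6 h11 h13 h3 h4
    exact eval_both (by simp [Expr.eval, h6, h13, h3]) (by simp [Expr.eval, h11, h13, h4])
  intro s2 hrep2 hr2 hp2 hmark2 hother2
  have hbelow : ∀ b < I.n, s2.tabs 5 1 b = 0 ↔ ¬ I.Below R u b := by
    intro b hb
    rw [hother2 1 b (by norm_num), hmark1 b hb]
    refine not_congr (or_congr_right ⟨?_, ?_⟩)
    · rintro ⟨x, -, h1, h2⟩
      exact ⟨x, h1, (hK x (hR.refl h1).2).1.1 h2⟩
    · rintro ⟨x, h1, h2⟩
      exact ⟨x, (hR.lt h1).2, h1, (hK x (hR.refl h1).2).1.2 h2⟩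
  have habove : ∀ b < I.n, s2.tabs 5 2 b = 0 ↔ ¬ I.Above R u b := by
    intro b hb
    rw [hmark2 b hb]
    refine not_congr (or_congr_right ⟨?_, ?_⟩)
    · rintro ⟨x, -, h1, h2⟩
      exact ⟨x, (hK x (hR.refl h2).1).2.1 h1, h2⟩
    · rintro ⟨x, h1, h2⟩
      exact ⟨x, (hR.lt h2).1, (hK x (hR.refl h2).1).2.2 h1, h2⟩
  have hbelow_lt : ∀ b, I.Below R u b → b < I.n := by
    rintro b (rfl | ⟨x, h1, -⟩)
    · exact hun
    · exact (hR.lt h1).1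
  have habove_lt : ∀ b, I.Above R u b → b < I.n := by
    rintro b (rfl | ⟨x, -, h1⟩)
    · exact hun
    · exact (hR.lt h1).2
  -- The entries lexicographically before `(i, j)` have been updated; `tabs 5` keeps the marks.
  let J : ℕ → ℕ → Mem → Prop := fun i j s' =>
    I.Rep a (fun b c => R b c ∨ (I.Below R u b ∧ I.Above R u c ∧ (b < i ∨ b = i ∧ c < j))) K ptr s' ∧
      s'.regs 5 = r ∧ s'.regs 6 = u ∧ s'.probes = s.probes ∧ s'.tabs 5 = s2.tabs 5
  have hJreg : ∀ {i j s' x} b, 7 ≤ x → J i j s' → J i j (s'.setReg x b) := by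
    rintro i j s' x b hx ⟨h1, h2, h3, h4, h5⟩
    refine ⟨h1.setReg b (by omega), ?_, ?_, h4, h5⟩
    · rw [Mem.regs_setReg, if_neg (by omega), h2]
    · rw [Mem.regs_setReg, if_neg (by omega), h3]
  have hJcongr : ∀ {i j i' j' s'}, (∀ b c, I.Below R u b → I.Above R u c →
      ((b < i ∨ b = i ∧ c < j) ↔ (b < i' ∨ b = i' ∧ c < j'))) → J i j s' → J i' j' s' := by
    rintro i j i' j' s' hiff ⟨h1, h2⟩
    refine ⟨?_, h2⟩
    convert h1 using 1
    funext b c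
    refine propext (or_congr_right (and_congr_right fun hb => and_congr_right fun hc => ?_))
    exact (hiff b c hb hc).symm
  refine .forLoop (n := I.n) (fun i s' => J i 0 s') (by norm_num) hM hrep2.n_eq ?_ ?_ ?_
  · refine hJreg _ (by norm_num) ⟨?_, ?_, ?_, ?_, rfl⟩
    · convert hrep2 using 1
      funext b c
      simp
    · rw [hr2 5 (by norm_num), hr1 5 (by norm_num), h5]
    · rw [hr2 6 le_rfl, hu1]
    · rw [hp2, hp1]
  · rintro i s3 hi - h11 hJ
    refine .forLoop (n := I.n) (fun j s' => J i j s' ∧ s'.regs 11 = i) (by norm_num) hM hJ.1.n_eq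
      ?_ ?_ ?_
    · exact ⟨hJreg _ (by norm_num) hJ, by simp [h11]⟩
    · rintro j s4 hj h04 h12 ⟨hJ4, h114⟩
      have h45 := hJ4.2.2.2.2
      have hskip : ¬ (I.Below R u i ∧ I.Above R u j) → J i (j + 1) s4 := by
        intro hn
        refine hJcongr (fun b c hb hc => ?_) hJ4
        constructor
        · omega
        · rintro (h | ⟨rfl, h⟩)
          · exact Or.inl h
          · refine Or.inr ⟨rfl, ?_⟩
            rcases Nat.lt_succ_iff_lt_or_eq.1 h with h | rfl
            · exact h
            · exact absurd ⟨hb, hc⟩ hn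
      have hfin : ∀ s', s'.regs = s4.regs → J i (j + 1) s' → s'.regs 0 = I.n ∧ s'.regs 12 = j ∧
          J i (j + 1) (s'.setReg 12 (j + 1)) ∧ (s'.setReg 12 (j + 1)).regs 11 = i := by
        intro s' hs' hJ'
        refine ⟨by rw [hs', h04], by rw [hs', h12], hJreg _ (by norm_num) hJ', ?_⟩
        simp [hs', h114]
      refine .cond (fun hc => .cond (fun hc' => .store ?_) (fun hc' => .skip ?_))
        (fun hc => .skip ?_)
      · simp only [Mem.value_entry, Mem.value_const, Mem.value_reg, h114, h12, h45, ne_eq,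
          hbelow i hi, habove j hj, not_not] at hc hc'
        refine hfin _ rfl ⟨?_, hJ4.2⟩
        simp only [Mem.value_const, Mem.value_reg, h114, h12]
        have := hJ4.1.setReach i j
        convert this using 1
        funext b c
        refine propext ?_
        rw [or_assoc]
        refine or_congr_right ?_
        constructor
        · rintro ⟨hb, hc, h⟩
          by_cases hbc : b = i ∧ c = j
          · exact Or.inr hbc
          · exact Or.inl ⟨hb, hc, by omega⟩
        · rintro (⟨hb, hc, h⟩ | ⟨rfl, rfl⟩)
          · exact ⟨hb, hc, by omega⟩
          · exact ⟨hc, hc', by omega⟩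
      · simp only [Mem.value_entry, Mem.value_const, Mem.value_reg, h12, h45, habove j hj] at hc'
        exact hfin _ rfl (hskip fun h => hc' h.2)
      · simp only [Mem.value_entry, Mem.value_const, Mem.value_reg, h114, h45, hbelow i hi] at hc
        exact hfin _ rfl (hskip fun h => hc h.1)
    · rintro s4 h04 ⟨hJ4, h114⟩
      refine ⟨h04, h114, hJreg _ (by norm_num) (hJcongr (fun b c hb hc => ?_) hJ4)⟩
      have := habove_lt c hc
      omega
  · rintro s3 - hJ
    refine hQ s3 ?_ hJ.2.1 hJ.2.2.1 hJ.2.2.2.1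
    convert hJ.1 using 1
    funext b c
    refine propext (or_congr_right ⟨?_, ?_⟩)
    · rintro ⟨hb, hc⟩
      exact ⟨hb, hc, Or.inl (hbelow_lt b hb)⟩
    · rintro ⟨hb, hc, -⟩
      exact ⟨hb, hc⟩

/-! ### Attempts, rounds and output -/

theorem wp_attempt {t r : ℕ} (hM : 3 * (I.n * I.n) + 2 ≤ M) (ht : t < I.n * I.n)
    (htu : t % I.n = u) (ha : ∀ x < I.n, ∀ y < I.n, ∃ j < I.n * I.n, a j = (x, y))
    (h : I.ScanState a t r u K ptr s) :
    SortProg.attempt.WP I.oracle M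
      (fun s' => ∃ K' ptr', I.ScanState a (t + 1) r u K' ptr' s') s := by
  have hn : 0 < I.n := Nat.pos_of_ne_zero fun h => by simp [h] at ht
  have hun : u < I.n := htu ▸ Nat.mod_lt _ hn
  have hMn : I.n ≤ M := by nlinarith
  have hrel : I.rel (t + 1) = I.attemptRel (I.rel t) u := by rw [← htu]; rfl
  have hsame : I.rel (t + 1) = I.rel t → ∀ {K ptr s'}, I.ScanState a t r u K ptr s' →
      I.ScanState a (t + 1) r u K ptr s' := by
    rintro heq K ptr s' ⟨h5, h6, hrep, hinv⟩
    refine ⟨h5, h6, ?_, hinv.next_of_rel_eq heq⟩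
    rwa [heq]
  have hv : s.value (.entry 4 (.reg 6) (.reg 6)) = ind (I.rel t u u) := by
    simp [h.2.1, h.2.2.1.reach]
  refine .cond (fun hc => .skip ⟨K, ptr, hsame ?_ h⟩) (fun hc => .seq ((wp_scan hM ht h).mono ?_))
  · rw [hv, ne_eq, ind_eq_zero, not_not] at hc
    rw [hrel, attemptRel, if_pos (Or.inl hc)]
  rw [hv, ind_eq_zero] at hc
  rintro s1 ⟨K1, ptr1, hst, hfin⟩
  have hpos : s1.value (.sub (.reg 1) SortProg.position) = I.n * I.n - ptr1 u := by
    simp [SortProg.position, hst.2.1, hst.2.2.1.position, hst.2.2.1.size_eq]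
  refine .cond (fun hc1 => .skip ⟨K1, ptr1, hsame ?_ hst⟩) (fun hc1 => ?_)
  · rw [hpos] at hc1
    rw [hrel, attemptRel, if_pos (Or.inr (hfin.resolve_left (by omega)).2)]
  rw [hpos] at hc1
  have hp1 : ptr1 u = I.n * I.n := by omega
  obtain ⟨h51, h61, hrep1, hinv1⟩ := hst
  refine .seq (wp_search hMn ht.le hrep1 h51 h61 (hinv1.searchInv hp1 ha) ?_)
  intro K2 s2 hrep2 h52 h62 hs2 hempty
  have hR : I.rel (t + 1) = I.insertRel (I.rel t) u := by
    rw [hrel, attemptRel, if_neg]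
    rw [not_or, not_not]
    exact ⟨hc, hinv1.ideal hp1 ha⟩
  have hknown : ∀ x, I.rel t x x → (K2 x u ↔ I.H x u) ∧ (K2 u x ↔ I.H u x) := by
    obtain ⟨e, he, -⟩ := hs2.inv
    exact fun x hx => he.known_of_unknowns_eq_empty hempty hx
  refine wp_insert hMn (I.valid_rel ht.le) hrep2 h52 h62 hun hknown ?_
  intro s3 hrep3 h53 h63 hp3
  refine ⟨K2, ptr1, h53, h63, ?_, ?_⟩
  · rwa [hR]
  · rw [hp3]
    exact hs2.insert hempty hR hc hun ht.le

theorem wp_insertAll {Q : Mem → Prop} (hM : 3 * (I.n * I.n) + 2 ≤ M)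
    (ha : ∀ x < I.n, ∀ y < I.n, ∃ j < I.n * I.n, a j = (x, y))
    (h : I.Rep a (I.rel 0) K ptr s) (hi : I.Inv a 0 K ptr s.probes 0)
    (hQ : ∀ K' ptr' s', I.Rep a (I.rel (I.n * I.n)) K' ptr' s' →
      I.Inv a (I.n * I.n) K' ptr' s'.probes 0 → Q s') :
    SortProg.insertAll.WP I.oracle M Q s := by
  have hMn : I.n ≤ M := by nlinarith
  refine .forLoop (n := I.n) (fun r s' => ∃ K ptr, I.Rep a (I.rel (r * I.n)) K ptr s' ∧
    I.Inv a (r * I.n) K ptr s'.probes 0) (by norm_num) hMn h.n_eq ?_ ?_ ?_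
  · rw [Nat.zero_mul]
    exact ⟨K, ptr, h.setReg _ (by norm_num), hi⟩
  · rintro r s1 hr - h5 ⟨K1, ptr1, hrep1, hinv1⟩
    refine .forLoop (n := I.n) (fun u s' => ∃ K ptr, s'.regs 5 = r ∧
      I.Rep a (I.rel (r * I.n + u)) K ptr s' ∧
      I.Inv a (r * I.n + u) K ptr s'.probes 0) (by norm_num) hMn hrep1.n_eq ?_ ?_ ?_
    · exact ⟨K1, ptr1, by simp [h5], hrep1.setReg _ (by norm_num), hinv1⟩
    · rintro u s2 hu - h6 ⟨K2, ptr2, h52, hrep2, hinv2⟩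
      have hlt : r * I.n + u < I.n * I.n := by nlinarith
      have hmod : (r * I.n + u) % I.n = u := by
        rw [mul_comm, Nat.mul_add_mod, Nat.mod_eq_of_lt hu]
      refine (wp_attempt hM hlt hmod ha (r := r) ⟨h52, h6, hrep2, hinv2⟩).mono ?_
      rintro s3 ⟨K3, ptr3, h53, h63, hrep3, hinv3⟩
      exact ⟨hrep3.n_eq, h63, K3, ptr3, by simp [h53], hrep3.setReg _ (by norm_num), hinv3⟩
    · rintro s2 - ⟨K2, ptr2, h52, hrep2, hinv2⟩
      rw [← Nat.succ_mul] at hrep2 hinv2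
      exact ⟨hrep2.n_eq, h52, K2, ptr2, hrep2.setReg _ (by norm_num), hinv2⟩
  · rintro s1 - ⟨K1, ptr1, hrep1, hinv1⟩
    exact hQ K1 ptr1 s1 hrep1 hinv1

/-- In the final linear order, the number of vertices that reach a vertex, itself included, is its
position plus one. -/
theorem wp_output {Q : Mem → Prop} (hM : I.n ≤ M)
    (h : I.Rep a (I.rel (I.n * I.n)) K ptr s)
    (hQ : ∀ s', (∀ i < I.n, s'.tabs 1 0 i = I.v i) → s'.probes = s.probes → Q s') :
    SortProg.output.WP I.oracle M Q s := by
  classical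
  refine .forLoop (n := I.n) (fun k s' => I.Rep a (I.rel (I.n * I.n)) K ptr s' ∧
    s'.probes = s.probes ∧ ∀ x < k, s'.tabs 1 0 (I.pos x) = x) (by norm_num) hM h.n_eq ?_ ?_ ?_
  · exact ⟨h.setReg _ (by norm_num), rfl, by simp⟩
  · rintro k s1 hk - h6 ⟨hrep, hp, hout⟩
    refine .seq (.sumLoop (n := I.n) (fun x => ind (I.rel (I.n * I.n) x k)) (by norm_num)
      (by norm_num) (by norm_num) hM hrep.n_eq ?_ ?_)
    · intro x regs hregs hx _
      simp [Expr.eval, hx, hregs 6 (by norm_num) (by norm_num), h6, hrep.reach]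
    · intro regs hregs hsum
      rw [sum_ind] at hsum
      have hcard : ((Finset.range I.n).filter fun x => I.rel (I.n * I.n) x k).card =
          I.pos k + 1 := by
        rw [← Finset.card_range (I.pos k + 1)]
        symm
        refine Finset.card_bij (fun i _ => I.v i) ?_ ?_ ?_
        · intro i hi
          have hik := Finset.mem_range.1 hi
          have hin : i < I.n := by have := I.pos_lt hk; omega
          rw [Finset.mem_filter, Finset.mem_range]
          refine ⟨I.v_lt hin, (I.rel_final (I.v_lt hin) hk).2 ?_⟩
          rw [I.pos_v hin]
          omega
        · intro i hi j hj hij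
          have hpk := I.pos_lt hk
          have hi' := Finset.mem_range.1 hi
          have hj' := Finset.mem_range.1 hj
          rw [← I.pos_v (i := i) (by omega), hij, I.pos_v (by omega)]
        · intro x hx
          rw [Finset.mem_filter, Finset.mem_range] at hx
          refine ⟨I.pos x, ?_, I.v_pos hx.1⟩
          have := (I.rel_final hx.1 hk).1 hx.2
          rw [Finset.mem_range]
          omega
      have h62 := (hregs 6 (by norm_num) (by norm_num)).trans h6
      have hrep2 : I.Rep a (I.rel (I.n * I.n)) K ptr ⟨regs, s1.tabs, s1.probes⟩ :=
        hrep.congr (hregs 0 (by norm_num) (by norm_num)) (hregs 1 (by norm_num) (by norm_num)) rfl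
      refine .store ?_
      simp only [Mem.value_sub, Mem.value_reg, Mem.value_const, hsum, hcard, h62,
        Nat.add_sub_cancel]
      refine ⟨hrep2.n_eq, h62, (hrep2.setOther _ _ (Or.inl rfl)).setReg _ (by norm_num), hp, ?_⟩
      intro x hx
      simp only [Mem.tabs_setReg, Mem.tabs_setEntry, true_and]
      split_ifs with hxk
      · rw [← I.v_pos hk, ← hxk, I.v_pos (by omega)]
      · refine hout x ?_
        rcases Nat.lt_succ_iff_lt_or_eq.1 hx with h | rfl
        · exact h
        · exact absurd rfl hxk
  · rintro s1 - ⟨hrep, hp, hout⟩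
    refine hQ s1 (fun i hi => ?_) hp
    have := hout (I.v i) (I.v_lt hi)
    rwa [I.pos_v hi] at this

end PathInstance

namespace PathInstance

variable {I : PathInstance} {s : Mem} {M : ℕ}

/-! ### The random order of the pairs -/

/-- The pairs listed in the memory. -/
def listed (s : Mem) (j : ℕ) : ℕ × ℕ := (s.tabs 2 0 j, s.tabs 2 1 j)

/-- The memory after the first `i` steps of the random permutation. -/
structure Shuffling (I : PathInstance) (i : ℕ) (s : Mem) : Prop where
  n_eq : s.regs 0 = I.n
  size_eq : s.regs 1 = I.n * I.n
  index : s.regs 3 = i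
  probes : s.probes = 0
  predicted : ∀ x y, s.tabs 0 x y = ind (I.P x y)
  arcs : ∀ x y, s.tabs 3 x y = 0
  reach : ∀ x y, s.tabs 4 x y = 0
  position : ∀ x, s.tabs 5 0 x = 0
  surj : ∀ x < I.n, ∀ y < I.n, ∃ j < I.n * I.n, listed s j = (x, y)

theorem wp_listPairs {Q : Mem → Prop} (hM : I.n ≤ M) (h0 : s.regs 0 = I.n)
    (hQ : ∀ s', s'.regs 0 = I.n → s'.regs 1 = I.n * I.n → s'.probes = s.probes →
      (∀ t, t ≠ 2 → s'.tabs t = s.tabs t) →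
      (∀ x < I.n, ∀ y < I.n, ∃ j < I.n * I.n, listed s' j = (x, y)) → Q s') :
    SortProg.listPairs.WP I.oracle M Q s := by
  let J : ℕ → Mem → Prop := fun k s' => s'.regs 1 = k ∧ s'.probes = s.probes ∧
    (∀ t, t ≠ 2 → s'.tabs t = s.tabs t) ∧ ∀ j < k, listed s' j = (j / I.n, j % I.n)
  have hJ : ∀ {k s' x} b, x ≠ 1 → J k s' → J k (s'.setReg x b) := by
    rintro k s' x b hx ⟨h1, h2⟩
    exact ⟨by rw [Mem.regs_setReg, if_neg hx.symm, h1], h2⟩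
  refine .seq (.assign (.forLoop (n := I.n) (fun x s' => J (x * I.n) s') (by norm_num) hM
    (by simp [h0]) ?_ ?_ ?_))
  · rw [Nat.zero_mul]
    exact hJ _ (by norm_num) ⟨by simp, rfl, fun _ _ => rfl, by simp⟩
  · intro x s1 hx hs1 h5 hJ1
    refine .forLoop (n := I.n) (fun y s' => s'.regs 5 = x ∧ J (x * I.n + y) s') (by norm_num) hM
      hs1 ?_ ?_ ?_
    · exact ⟨by simp [h5], hJ _ (by norm_num) hJ1⟩
    · rintro y s2 hy hs2 h6 ⟨h52, h1, h2, h3, h4⟩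
      refine .seq (.store (.seq (.store (.assign ?_))))
      simp only [Mem.value_add, Mem.value_reg, Mem.value_const, Mem.regs_setEntry, h1, h52, h6]
      refine ⟨by simp [hs2], by simp [h6], by simp [h52], hJ _ (by norm_num) ⟨?_, h2, ?_, ?_⟩⟩
      · simp [add_assoc]
      · intro t ht
        rw [← h3 t ht]
        funext i j
        simp [ht]
      · intro j hj
        rcases (show j < x * I.n + y ∨ j = x * I.n + y by omega) with hj | rfl
        · rw [← h4 j hj]
          simp [listed, hj.ne]
        · have hd : (x * I.n + y) / I.n = x := by
            rw [mul_comm, Nat.mul_add_div (by omega), Nat.div_eq_of_lt hy, add_zero]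
          have hm : (x * I.n + y) % I.n = y := by
            rw [mul_comm, Nat.mul_add_mod, Nat.mod_eq_of_lt hy]
          rw [hd, hm]
          simp [listed]
    · rintro s2 hs2 ⟨h52, hJ2⟩
      rw [← Nat.succ_mul] at hJ2
      exact ⟨hs2, h52, hJ _ (by norm_num) hJ2⟩
  · rintro s1 hs1 ⟨h1, h2, h3, h4⟩
    refine hQ s1 hs1 h1 h2 h3 fun x hx y hy => ⟨x * I.n + y, by nlinarith, ?_⟩
    rw [h4 _ (by nlinarith), mul_comm, Nat.mul_add_div (by omega), Nat.div_eq_of_lt hy, add_zero,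
      Nat.mul_add_mod, Nat.mod_eq_of_lt hy]

/-- The case `k = 0` is included; it occurs when the shuffle leaves an entry in place. -/
theorem wp_exchange {o : ℕ → ℕ → Option Bool} {row i k : ℕ} {Q : Mem → Prop}
    (hi : s.regs 3 = i) (hk : s.regs 2 = k)
    (hQ : ∀ s', (∀ y ≠ 4, s'.regs y = s.regs y) → s'.probes = s.probes →
      (∀ t b c, s'.tabs t b c =
        if t = 2 ∧ b = row then s.tabs 2 row (Equiv.swap i (i + k) c) else s.tabs t b c) → Q s') :
    (SortProg.exchange row).WP o M Q s := by
  refine .seq (.assign (.seq (.store (.store (hQ _ ?_ rfl ?_)))))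
  · intro y hy
    simp [hy]
  · intro t b c
    simp only [Mem.value_add, Mem.value_reg, Mem.value_const, Mem.value_entry, Mem.regs_setEntry,
      Mem.regs_setReg, Mem.tabs_setEntry, Mem.tabs_setReg, hi, hk, if_true, Equiv.swap_apply_def,
      Nat.reduceEqDiff, if_false]
    by_cases ht : t = 2 ∧ b = row
    · obtain ⟨rfl, rfl⟩ := ht
      simp only [true_and, and_self, if_true]
      rcases eq_or_ne k 0 with rfl | hk0
      · by_cases h1 : c = i <;> simp [h1]
      · by_cases h1 : c = i + k
        · simp [h1, hk0]
        · by_cases h2 : c = i <;> simp [h1, h2, hk0]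
    · rw [if_neg ht, if_neg (fun h => ht ⟨h.1, h.2.1⟩), if_neg (fun h => ht ⟨h.1, h.2.1⟩)]

theorem wp_shuffleStep {i k : ℕ} {Q : Mem → Prop} (h : I.Shuffling i s) (hk : s.regs 2 = k)
    (hik : i + k < I.n * I.n)
    (hQ : ∀ s', I.Shuffling (i + 1) s' → listed s' = listed s ∘ Equiv.swap i (i + k) → Q s') :
    SortProg.shuffleStep.WP I.oracle M Q s := by
  refine .seq (wp_exchange h.index hk fun s1 hr1 hp1 ht1 => .seq (wp_exchange (i := i) (k := k)
    ((hr1 3 (by norm_num)).trans h.index) ((hr1 2 (by norm_num)).trans hk)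
    fun s2 hr2 hp2 ht2 => .assign ?_))
  have hr : ∀ y ≠ 4, s2.regs y = s.regs y := fun y hy => (hr2 y hy).trans (hr1 y hy)
  have hlist : listed s2 = listed s ∘ Equiv.swap i (i + k) := by
    funext j
    simp [listed, ht2, ht1]
  refine hQ _ ⟨?_, ?_, ?_, ?_, ?_, ?_, ?_, ?_, ?_⟩ hlist
  · simp [hr, h.n_eq]
  · simp [hr, h.size_eq]
  · simp [hr, h.index]
  · exact (hp2.trans hp1).trans h.probes
  · intro x y
    simp [ht2, ht1, h.predicted]
  · intro x y
    simp [ht2, ht1, h.arcs]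
  · intro x y
    simp [ht2, ht1, h.reach]
  · intro x
    simp [ht2, ht1, h.position]
  · intro x hx y hy
    obtain ⟨j, hj, hj'⟩ := h.surj x hx y hy
    refine ⟨Equiv.swap i (i + k) j, ?_, ?_⟩
    · rw [Equiv.swap_apply_def]
      split_ifs <;> omega
    · change listed s2 _ = _
      rw [hlist]
      simpa using hj'

/-- The sum of the potentials of all vertices. -/
noncomputable def potential (I : PathInstance) (a : ℕ → ℕ × ℕ) (i : ℕ) : ℕ :=
  ∑ u ∈ Finset.range I.n, recordPotential (I.weight u) a (I.n * I.n) i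

/-- Induction on the number of draws still to come. The failure bound is the potential over `D`, and
by `sum_recordPotential_swap_le`, summed over the vertices, averaging over a draw does not increase
it. -/
theorem ends_shuffle {S : Config → Prop} {B : Set Config} {r : List Prog} {K D : ℕ}
    (hend : ∀ s, I.Shuffling (I.n * I.n) s → (s.config r).Ends I.oracle S B K
      ((I.potential (listed s) (I.n * I.n) : ℕ) / (D : ℕ)))
    {i : ℕ} (hi : i ≤ I.n * I.n) (h : I.Shuffling i s) :
    (s.config (.loop (.sub (.reg 1) (.reg 3)) (.seq (.draw 2 (.sub (.sub (.reg 1) (.reg 3))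
      (.const 1))) SortProg.shuffleStep) :: r)).Ends I.oracle S B
      ((I.n * I.n - i) * (SortProg.shuffleStep.time M + 3) + (1 + K))
      ((I.potential (listed s) i : ℕ) / (D : ℕ)) := by
  obtain ⟨m, hm⟩ := Nat.exists_eq_add_of_le hi
  induction m generalizing i s with
  | zero =>
    obtain rfl : i = I.n * I.n := by omega
    rw [Nat.sub_self, Nat.zero_mul, Nat.zero_add]
    refine .of_run (d := s.config r) ?_ (hend s h)
    rw [Config.run_one]
    simp [Config.step, Mem.config, Config.value, Expr.eval, h.size_eq, h.index]
  | succ m ih =>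
    have hv : s.value (.sub (.sub (.reg 1) (.reg 3)) (.const 1)) + 1 = I.n * I.n - i := by
      simp only [Mem.value_sub, Mem.value_reg, Mem.value_const, h.size_eq, h.index]
      omega
    have hne : s.value (.sub (.reg 1) (.reg 3)) ≠ 0 := by
      simp only [Mem.value_sub, Mem.value_reg, h.size_eq, h.index]
      omega
    have hsub : I.n * I.n - i = (I.n * I.n - (i + 1)) + 1 := by omega
    set L : Prog := .loop (.sub (.reg 1) (.reg 3)) (.seq (.draw 2 (.sub (.sub (.reg 1) (.reg 3))
      (.const 1))) SortProg.shuffleStep) with hL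
    have hrun : Config.run I.oracle (s.config (L :: r)) 2 =
        PMF.pure (s.config (.draw 2 (.sub (.sub (.reg 1) (.reg 3)) (.const 1)) ::
          SortProg.shuffleStep :: L :: r)) := by
      simp only [Mem.value] at hne
      rw [show 2 = 1 + 1 from rfl, Config.run_add, Config.run_one]
      simp only [hL, Config.step, Mem.config, Config.value, ne_eq, hne, not_false_eq_true, if_true,
        PMF.pure_bind, Config.run_one]
    have hdraw := Config.Ends.draw (o := I.oracle) (S := S) (B := B) (s := s) (x := 2)
      (e := .sub (.sub (.reg 1) (.reg 3)) (.const 1)) (r := SortProg.shuffleStep :: L :: r)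
      (K := SortProg.shuffleStep.time M +
        ((I.n * I.n - (i + 1)) * (SortProg.shuffleStep.time M + 3) + (1 + K)))
      (f := fun k => ((I.potential (listed s ∘ Equiv.swap i (i + k)) (i + 1) : ℕ) : ℝ≥0∞) / (D : ℕ))
      (by
        intro k hk
        have hsh : I.Shuffling i (s.setReg 2 k) := by
          obtain ⟨c1, c2, c3, c4, c5, c6, c7, c8, c9⟩ := h
          exact ⟨by simp [c1], by simp [c2], by simp [c3], c4, c5, c6, c7, c8, c9⟩
        have hik : i + k < I.n * I.n := by omega
        have hwp : SortProg.shuffleStep.WP I.oracle M (fun s' => I.Shuffling (i + 1) s' ∧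
            listed s' = listed s ∘ Equiv.swap i (i + k)) (s.setReg 2 k) :=
          wp_shuffleStep hsh (k := k) (by simp) hik fun s' h1 h2 => ⟨h1, h2⟩
        refine Config.Ends.of_wp hwp ?_
        rintro s' ⟨h1, h2⟩
        rw [← h2]
        exact ih (by omega) h1 (by omega))
    have hall := Config.Ends.of_run hrun hdraw
    refine Config.Ends.mono hall ?_ ?_
    · rw [hsub, Nat.succ_mul]
      omega
    · rw [hv]
      simp only [div_eq_mul_inv]
      rw [← Finset.sum_mul, ← Nat.cast_sum, mul_right_comm]
      refine mul_le_mul_left ?_ _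
      rw [← div_eq_mul_inv]
      refine ENNReal.div_le_of_le_mul ?_
      rw [← Nat.cast_mul]
      refine Nat.cast_le.2 ?_
      unfold potential
      rw [Finset.sum_comm, Finset.sum_mul]
      refine Finset.sum_le_sum fun u _ => ?_
      have hlt : i < I.n * I.n := by omega
      exact (sum_recordPotential_swap_le (I.weight u) (listed s) hlt).trans_eq (mul_comm _ _)

/-- The bound for the number of probes after the pairs have been put into the order `a`. -/
noncomputable def probeBound (I : PathInstance) (a : ℕ → ℕ × ℕ) (w : ℕ) : ℕ :=
  ∑ u ∈ Finset.range I.n, 2 * recordCount (I.weight u) a (I.n * I.n) + 2 * w +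
    I.n * Nat.size I.n

theorem wp_insertAll_output {Q : Mem → Prop} {w : ℕ} (hM : 3 * (I.n * I.n) + 2 ≤ M)
    (h : I.Shuffling (I.n * I.n) s)
    (hw : ∀ K : ℕ → ℕ → Prop, (∀ x y, K x y → I.H x y) → I.knownWrong K ≤ w)
    (hQ : ∀ s', (∀ i < I.n, s'.tabs 1 0 i = I.v i) →
      s'.probes ≤ I.probeBound (listed s) w → Q s') :
    (Prog.seq SortProg.insertAll SortProg.output).WP I.oracle M Q s := by
  classical
  have hrep : I.Rep (listed s) (I.rel 0) (fun _ _ => False) (fun _ => 0) s := by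
    refine ⟨h.n_eq, h.size_eq, h.predicted, fun _ => rfl, ?_, ?_, h.position⟩
    · intro x y
      rw [h.arcs, ind_neg not_false]
    · intro x y
      rw [h.reach]
      exact (ind_neg not_false).symm
  have hinv : I.Inv (listed s) 0 (fun _ _ => False) (fun _ => 0) s.probes 0 := by
    refine ⟨False.elim, fun _ => Nat.zero_le _, fun u j hj => absurd hj (Nat.not_lt_zero j),
      fun u hu => hu.elim, ?_⟩
    rw [h.probes]
    exact Nat.zero_le _
  refine .seq (wp_insertAll hM h.surj hrep hinv fun K ptr s1 hrep1 hinv1 => ?_)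
  refine wp_output (by nlinarith) hrep1 fun s2 hout hp => hQ s2 hout ?_
  rw [hp]
  refine hinv1.probes.trans ?_
  rw [add_zero]
  unfold cost probeBound
  have h1 := hw K fun _ _ => hinv1.sound
  have h2 : I.inserted (I.rel (I.n * I.n)) ≤ I.n :=
    (Finset.card_filter_le _ _).trans (Finset.card_range _).le
  gcongr with u hu
  exact stops_le K u _

/-- The bound for the number of iterations of a loop. -/
def iterations (n : ℕ) : ℕ := 3 * (n * n) + n + 2

/-- The bound for the number of steps. -/
def steps (n : ℕ) : ℕ :=
  1 + (SortProg.listPairs.time (iterations n) + (3 + (n * n *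
    (SortProg.shuffleStep.time (iterations n) + 3) +
      (1 + ((Prog.seq SortProg.insertAll SortProg.output).time (iterations n) + 0)))))

theorem polyBounded_steps : PolyBounded steps := by
  have hM : PolyBounded iterations :=
    (((PolyBounded.const 3).mul (PolyBounded.id.mul PolyBounded.id)).add PolyBounded.id).add
      (PolyBounded.const 2)
  exact (PolyBounded.const 1).add ((hM.time _).add ((PolyBounded.const 3).add
    (((PolyBounded.id.mul PolyBounded.id).mul ((hM.time _).add (PolyBounded.const 3))).add
      ((PolyBounded.const 1).add ((hM.time _).add (PolyBounded.const 0))))))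

/-- Markov's inequality and the union bound in one: the failure bound is the initial total potential
divided by the threshold `D`. -/
theorem ends_main {S : Config → Prop} {B : Set Config} {w D : ℕ}
    (h0 : s.regs 0 = I.n) (hp : s.probes = 0)
    (hP : ∀ x y, s.tabs 0 x y = ind (I.P x y)) (ht : ∀ t ≠ 0, ∀ x y, s.tabs t x y = 0)
    (hw : ∀ K : ℕ → ℕ → Prop, (∀ x y, K x y → I.H x y) → I.knownWrong K ≤ w)
    (hS : ∀ s' : Mem, (∀ i < I.n, s'.tabs 1 0 i = I.v i) → S (s'.config []))
    (hB : ∀ (s' : Mem) a, (∀ u < I.n, 2 ^ recordCount (I.weight u) a (I.n * I.n) < D) →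
      s'.probes ≤ I.probeBound a w → s'.config [] ∈ B) (hD : D ≠ 0) :
    (s.config [SortProg.main]).Ends I.oracle S B (steps I.n)
      ((I.n * (1 + I.n * I.n) : ℕ) / (D : ℕ)) := by
  have hM : 3 * (I.n * I.n) + 2 ≤ iterations I.n := by unfold iterations; omega
  have hMn : I.n ≤ iterations I.n := by unfold iterations; omega
  have hD' : (D : ℝ≥0∞) ≠ 0 := Nat.cast_ne_zero.2 hD
  have hend : ∀ s, I.Shuffling (I.n * I.n) s →
      (s.config [Prog.seq SortProg.insertAll SortProg.output]).Ends I.oracle S B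
        ((Prog.seq SortProg.insertAll SortProg.output).time (iterations I.n) + 0)
        ((I.potential (listed s) (I.n * I.n) : ℕ) / (D : ℕ)) := by
    intro s hs
    refine .of_wp (wp_insertAll_output (w := w) (Q := fun s' =>
      (∀ i < I.n, s'.tabs 1 0 i = I.v i) ∧ s'.probes ≤ I.probeBound (listed s) w) hM hs hw
        fun s' h1 h2 => ⟨h1, h2⟩) ?_
    rintro s' ⟨h1, h2⟩
    refine .of_halted rfl (hS s' h1) fun hnot => ?_
    -- Failure means that some vertex has `2 ^ records ≥ D`, and this power is one summand of the
    -- final potential.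
    have : D ≤ I.potential (listed s) (I.n * I.n) := by
      by_contra hcon
      refine hnot (hB s' (listed s) (fun u hu => ?_) h2)
      refine lt_of_le_of_lt ?_ (not_le.1 hcon)
      unfold potential
      rw [← recordPotential_self]
      exact Finset.single_le_sum
        (f := fun u => recordPotential (I.weight u) (listed s) (I.n * I.n) (I.n * I.n))
        (fun _ _ => Nat.zero_le _) (Finset.mem_range.2 hu)
    rw [ENNReal.le_div_iff_mul_le (Or.inl hD') (Or.inl (ENNReal.natCast_ne_top D)), one_mul]
    exact Nat.cast_le.2 this
  refine .of_run (k := 1) (d := s.config [SortProg.listPairs, .seq SortProg.shuffle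
    (.seq SortProg.insertAll SortProg.output)]) (by rw [Config.run_one]; rfl) ?_
  refine .of_wp (Q := fun s' => ∀ b, I.Shuffling 0 (s'.setReg 3 0) ∧
    I.potential (listed (s'.setReg 3 b)) 0 ≤ I.n * (1 + I.n * I.n))
    (wp_listPairs hMn h0 fun s' c0 c1 cp ct cl b => ⟨⟨?_, ?_, ?_, ?_, ?_, ?_, ?_, ?_, ?_⟩, ?_⟩) ?_
  · simp [c0]
  · simp [c1]
  · simp
  · exact cp.trans hp
  · intro x y
    simp [ct, hP]
  · intro x y
    simp [ct, ht]
  · intro x y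
    simp [ct, ht]
  · intro x
    simp [ct, ht]
  · exact cl
  · unfold potential
    refine (Finset.sum_le_card_nsmul _ _ _ fun u _ => recordPotential_zero_le _ _ _).trans ?_
    simp
  · intro s1 hs1
    have hrun : Config.run I.oracle (s1.config [.seq SortProg.shuffle
        (.seq SortProg.insertAll SortProg.output)]) 3 = PMF.pure ((s1.setReg 3 0).config
          [.loop (.sub (.reg 1) (.reg 3)) (.seq (.draw 2 (.sub (.sub (.reg 1) (.reg 3))
            (.const 1))) SortProg.shuffleStep), .seq SortProg.insertAll SortProg.output]) := by
      simp only [Config.run, PMF.pure_bind, Config.step, Mem.config, SortProg.shuffle]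
      rfl
    refine .of_run hrun ?_
    have := ends_shuffle (M := iterations I.n) hend (Nat.zero_le _) (hs1 0).1
    refine this.mono le_rfl ?_
    gcongr
    exact (hs1 0).2

end PathInstance

/-! ### The theorem -/

/-- The paths of an acyclic directed graph follow the order of a directed Hamiltonian path. -/
theorem getElem_lt_of_adj {V : Type*} {D : Digraph V} {l : List V} (hc : l.IsChain D.Adj)
    (hD : IsAcyclicDigraph D) {i j : ℕ} (hi : i < l.length) (hj : j < l.length)
    (h : D.Adj l[i] l[j]) : i < j := by
  by_contra hij
  have key : ∀ k, j ≤ k → (hk : k < l.length) → Relation.ReflTransGen D.Adj l[j] l[k] := by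
    intro k hjk
    induction k, hjk using Nat.le_induction with
    | base => exact fun _ => .refl
    | succ k _ ih =>
      intro hk
      exact (ih (by omega)).tail (List.isChain_iff_getElem.1 hc k hk)
  exact hD _ (Relation.TransGen.tail' (key i (by omega) hi) h)

theorem SortingInstance.length_hamiltonian {n : ℕ} (I : SortingInstance n) {l : List (Fin n)} (hl : IsDirectedHamiltonianPath I.hidden l) :
    l.length = n := by
  have h : l.toFinset = Finset.univ := Finset.eq_univ_of_forall fun x => by simpa using hl.2.1 x
  rw [← List.toFinset_card_of_nodup hl.1, h, Finset.card_univ, Fintype.card_fin]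

open Classical in
/-- The instance on natural numbers that belongs to a sorting instance with Hamiltonian
path `l`. -/
noncomputable def SortingInstance.toPathInstance {n : ℕ} (I : SortingInstance n) (l : List (Fin n))
    (hl : IsDirectedHamiltonianPath I.hidden l) : PathInstance :=
  have hlen : l.length = n := I.length_hamiltonian hl
  { n := n
    P := fun x y => ∃ (hx : x < n) (hy : y < n), I.predicted.Adj ⟨x, hx⟩ ⟨y, hy⟩
    H := fun x y => ∃ (hx : x < n) (hy : y < n), I.hidden.Adj ⟨x, hx⟩ ⟨y, hy⟩
    v := fun i => if h : i < n then (l[i]'(hlen.symm ▸ h)).val else 0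
    pos := fun x => if h : x < n then l.idxOf ⟨x, h⟩ else 0
    oracle := I.oracle
    P_lt := fun ⟨hx, hy, _⟩ => ⟨hx, hy⟩
    -- Acyclicity of the hidden orientation is used only here; afterwards it is encoded by
    -- positions.
    H_pos := by
      rintro x y ⟨hx, hy, h⟩
      have h1 := List.idxOf_lt_length_of_mem (hl.2.1 ⟨x, hx⟩)
      have h2 := List.idxOf_lt_length_of_mem (hl.2.1 ⟨y, hy⟩)
      simp only [hx, hy, dif_pos]
      refine getElem_lt_of_adj hl.2.2 I.hidden_acyclic h1 h2 ?_
      rwa [List.getElem_idxOf, List.getElem_idxOf]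
    v_lt := by
      intro i hi
      simp only [hi, dif_pos, Fin.is_lt]
    pos_lt := by
      intro x hx
      simp only [hx, dif_pos]
      exact (List.idxOf_lt_length_of_mem (hl.2.1 ⟨x, hx⟩)).trans_eq hlen
    pos_v := by
      intro i hi
      simp only [hi, dif_pos, Fin.is_lt, Fin.eta]
      exact hl.1.idxOf_getElem i _
    v_pos := by
      intro x hx
      have h1 := List.idxOf_lt_length_of_mem (hl.2.1 ⟨x, hx⟩)
      simp only [hx, dif_pos, hlen ▸ h1, List.getElem_idxOf]
    H_v := by
      intro i hi
      have hi' : i < n := by omega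
      simp only [hi, hi', dif_pos, Fin.is_lt, Fin.eta, exists_true_left]
      exact List.isChain_iff_getElem.1 hl.2.2 i (hlen.symm ▸ hi)
    edge := by
      rintro x y ⟨hx, hy, h⟩
      rcases I.predicted_orientation.2 _ _ (I.hidden_orientation.1 _ _ h) with h | h
      · exact Or.inl ⟨hx, hy, h.1⟩
      · exact Or.inr ⟨hy, hx, h.1⟩
    P_edge := by
      rintro x y ⟨hx, hy, h⟩
      rcases I.hidden_orientation.2 _ _ (I.predicted_orientation.1 _ _ h) with h | h
      · exact Or.inl ⟨hx, hy, h.1⟩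
      · exact Or.inr ⟨hy, hx, h.1⟩
    oracle_eq := by
      rintro x y ⟨hx, hy, h⟩
      have hG := I.predicted_orientation.1 _ _ h
      simp only [SortingInstance.oracle, hx, hy, and_self, dif_pos, hG, if_true,
        exists_true_left] }

namespace SortingInstance

variable {n : ℕ} (I : SortingInstance n) (l : List (Fin n))
  (hl : IsDirectedHamiltonianPath I.hidden l)

/-- A predicted arc whose reverse is a true arc is not itself a true arc. -/
theorem knownWrong_le (K : ℕ → ℕ → Prop)
    (hK : ∀ x y, K x y → (I.toPathInstance l hl).H x y) :
    (I.toPathInstance l hl).knownWrong K ≤ I.mispredicted := by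
  classical
  have hinj : Function.Injective fun e : Fin n × Fin n => ((e.1 : ℕ), (e.2 : ℕ)) := by
    rintro ⟨a, b⟩ ⟨c, d⟩ h
    simp only [Prod.mk.injEq] at h
    exact Prod.ext (Fin.ext h.1) (Fin.ext h.2)
  rw [SortingInstance.mispredicted, ← Set.ncard_image_of_injective _ hinj,
    PathInstance.knownWrong, ← Set.ncard_coe_finset]
  refine Set.ncard_le_ncard ?_ (Set.toFinite _)
  rintro ⟨x, y⟩ he
  simp only [Finset.coe_filter, Set.mem_ofPred_eq] at he
  obtain ⟨-, ⟨hx, hy, hP⟩, hK'⟩ := he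
  refine ⟨(⟨x, hx⟩, ⟨y, hy⟩), ⟨hP, fun hH => ?_⟩, rfl⟩
  exact (I.toPathInstance l hl).H_asymm (hK _ _ hK') ⟨hx, hy, hH⟩

theorem solved_of_output {s : Mem}
    (h : ∀ i < n, s.tabs 1 0 i = (I.toPathInstance l hl).v i) : I.Solved (s.config []) := by
  refine ⟨l, hl, ?_⟩
  have hlen := I.length_hamiltonian hl
  refine List.ext_getElem (by simp [hlen]) fun i h1 h2 => ?_
  have hi : i < n := by simpa using h1
  simp only [List.getElem_map, List.getElem_range]
  refine (h i hi).trans ?_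
  simp [toPathInstance, hi]

end SortingInstance

/-! ### Numerical estimates and conclusion -/

theorem size_le_log {n : ℕ} (hn : 2 ≤ n) : (Nat.size n : ℝ) ≤ 4 * Real.log n := by
  have hlog2 := Real.log_two_gt_d9
  have hn' : (2 : ℝ) ≤ n := by exact_mod_cast hn
  have h2 : Real.log 2 ≤ Real.log n := Real.log_le_log (by norm_num) hn'
  obtain ⟨k, hk⟩ := Nat.exists_eq_succ_of_ne_zero (Nat.size_pos.2 (by omega : 0 < n)).ne'
  have hpow : 2 ^ k ≤ n := Nat.lt_size.1 (by omega)
  have h3 : (k : ℝ) * Real.log 2 ≤ Real.log n := by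
    rw [← Real.log_pow]
    exact Real.log_le_log (by positivity) (by exact_mod_cast hpow)
  rw [hk]
  push_cast
  have : (0 : ℝ) ≤ k := by positivity
  nlinarith

/-- The threshold is at most `n ^ 5`, and `5 / log 2 < 10`. -/
theorem le_log_of_two_pow_lt {n r : ℕ} (hn : 2 ≤ n) (h : 2 ^ r < n * (n * (1 + n * n))) :
    (r : ℝ) ≤ 10 * Real.log n := by
  have hlog2 := Real.log_two_gt_d9
  have h1 : 1 + n * n ≤ n ^ 3 := by
    have : 2 * (n * n) ≤ n * (n * n) := Nat.mul_le_mul_right _ hn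
    have : 1 ≤ n * n := Nat.mul_pos (by omega) (by omega)
    calc 1 + n * n ≤ n * (n * n) := by omega
      _ = n ^ 3 := by ring
  have h2 : 2 ^ r ≤ n ^ 5 := by
    calc 2 ^ r ≤ n * (n * (1 + n * n)) := h.le
      _ ≤ n * (n * n ^ 3) := by gcongr
      _ = n ^ 5 := by ring
  have h3 : (r : ℝ) * Real.log 2 ≤ 5 * Real.log n := by
    rw [← Real.log_pow]
    have : Real.log ((n : ℝ) ^ 5) = 5 * Real.log n := by
      rw [Real.log_pow]
      norm_num
    rw [← this]
    exact Real.log_le_log (by positivity) (by exact_mod_cast h2)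
  have : (0 : ℝ) ≤ r := by positivity
  nlinarith

/-- The constant is `20` from two probes for each of at most `10 log n` records per vertex, plus `4`
from the binary searches; it also covers the `2` for each misprediction. -/
theorem PathInstance.probeBound_le (I : PathInstance) {a : ℕ → ℕ × ℕ} (w : ℕ) (hn : 2 ≤ I.n)
    (h : ∀ u < I.n, 2 ^ recordCount (I.weight u) a (I.n * I.n) <
      I.n * (I.n * (1 + I.n * I.n))) :
    (I.probeBound a w : ℝ) ≤ 24 * (I.n * Real.log I.n + w) := by
  have h1 : ((∑ u ∈ Finset.range I.n, 2 * recordCount (I.weight u) a (I.n * I.n) : ℕ) : ℝ) ≤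
      I.n * (20 * Real.log I.n) := by
    rw [Nat.cast_sum]
    refine (Finset.sum_le_card_nsmul _ _ (20 * Real.log I.n) fun u hu => ?_).trans ?_
    · have := le_log_of_two_pow_lt hn (h u (Finset.mem_range.1 hu))
      push_cast
      linarith
    · simp
  have h2 := mul_le_mul_of_nonneg_left (size_le_log hn) (Nat.cast_nonneg (α := ℝ) I.n)
  have h3 : (0 : ℝ) ≤ w := by positivity
  unfold PathInstance.probeBound
  push_cast at h1 ⊢
  nlinarith

/-- There are one program, one constant `C` and one polynomial `q` such that, on every instance
with `n` vertices and `w` mis-predicted edges, every run of the program halts within `q(n)` steps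
with the hidden Hamiltonian path as output, and with probability at least `1 - 1/n` it makes at
most `C (n log n + w)` probes. -/
theorem theorem1 :
    ∃ (p : Prog) (C : ℝ) (q : Polynomial ℕ),
      ∀ (n : ℕ) (I : SortingInstance n),
        (∀ c ∈ ((I.init p).run I.oracle (q.eval n)).support, c.Halted ∧ I.Solved c) ∧
        1 - 1 / (n : ℝ≥0∞) ≤
          ((I.init p).run I.oracle (q.eval n)).toOuterMeasure
            {c | (c.probes : ℝ) ≤ C * (n * Real.log n + I.mispredicted)} := by
  classical
  obtain ⟨q, hq⟩ := PathInstance.polyBounded_steps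
  refine ⟨SortProg.main, 24, q, fun n I => ?_⟩
  obtain ⟨l, hl⟩ := I.hidden_hamiltonian
  set J := I.toPathInstance l hl with hJ
  let s : Mem := ⟨(I.init SortProg.main).regs, (I.init SortProg.main).tabs, 0⟩
  have hends : ∀ (B : Set Config) (D : ℕ), D ≠ 0 →
      (∀ (s' : Mem) a, (∀ u < n, 2 ^ recordCount (J.weight u) a (n * n) < D) →
        s'.probes ≤ J.probeBound a I.mispredicted → s'.config [] ∈ B) →
      (I.init SortProg.main).Ends I.oracle (fun c => c.Halted ∧ I.Solved c) B
        (PathInstance.steps n) ((n * (1 + n * n) : ℕ) / (D : ℕ)) := by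
    intro B D hD hB
    refine PathInstance.ends_main (I := J) (s := s) (w := I.mispredicted) ?_ rfl ?_ ?_
      (I.knownWrong_le l hl) (fun s' h => ⟨rfl, I.solved_of_output l hl h⟩) hB hD
    · simp [s, SortingInstance.init, hJ, SortingInstance.toPathInstance]
    · intro x y
      simp only [s, SortingInstance.init, hJ, SortingInstance.toPathInstance, true_and, ind]
      by_cases hxy : x < n ∧ y < n
      · simp [hxy]
      · rw [dif_neg hxy, if_neg]
        rintro ⟨hx, hy, -⟩
        exact hxy ⟨hx, hy⟩
    · intro t ht x y
      simp [s, SortingInstance.init, ht]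
  rcases Nat.lt_or_ge n 2 with hn | hn
  · refine ⟨(hends Set.univ 1 one_ne_zero (fun _ _ _ _ => trivial) _ (hq n)).1, ?_⟩
    -- For `n < 2` the probability claim is void; for `n = 0` the quotient is infinite and the
    -- truncated difference is `0`.
    have key : ∀ m < 2, (1 : ℝ≥0∞) - 1 / (m : ℕ) = 0 := by
      intro m hm
      interval_cases m <;> simp
    rw [key n hn]
    exact zero_le
  · set B : Set Config := {c | (c.probes : ℝ) ≤ 24 * (n * Real.log n + I.mispredicted)} with hBdef
    have hpos : n * (1 + n * n) ≠ 0 := by positivity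
    -- The threshold is `n` times the bound `n * (1 + n * n)` for the initial potential, which makes
    -- the failure probability at most `1 / n`.
    have h := hends B (n * (n * (1 + n * n))) (by positivity) (fun s' a ha hp =>
      (Nat.cast_le.2 hp).trans (J.probeBound_le I.mispredicted hn ha)) _ (hq n)
    refine ⟨h.1, ?_⟩
    have hε : ((n * (1 + n * n) : ℕ) : ℝ≥0∞) / ((n * (n * (1 + n * n)) : ℕ) : ℝ≥0∞) =
        1 / (n : ℝ≥0∞) := by
      have h0 : ((n * (1 + n * n) : ℕ) : ℝ≥0∞) ≠ 0 := Nat.cast_ne_zero.2 hpos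
      rw [Nat.cast_mul n (n * (1 + n * n))]
      have := ENNReal.mul_div_mul_right 1 (n : ℝ≥0∞) h0 (ENNReal.natCast_ne_top _)
      rwa [one_mul] at this
    have h2 := h.2
    rw [hε] at h2
    set μ := (Config.run I.oracle (I.init SortProg.main) (q.eval n)) with hμ
    rw [tsub_le_iff_right]
    calc (1 : ℝ≥0∞) = μ.toOuterMeasure Set.univ := by
          rw [eq_comm, PMF.toOuterMeasure_apply_eq_one_iff]
          exact Set.subset_univ _
      _ ≤ μ.toOuterMeasure B + μ.toOuterMeasure Bᶜ := by
          rw [← Set.union_compl_self B]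
          exact MeasureTheory.measure_union_le _ _
      _ ≤ μ.toOuterMeasure B + 1 / (n : ℝ≥0∞) := by gcongr
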